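/- Let $n\ge 2$ and let $X$ be an $n$-dimensional building: a simplicial complex with a nonempty family of subcomplexes (apartments), each isomorphic to the Coxeter complex of a Coxeter system of rank $n+1$, such that any two simplices lie in a common apartment and, whenever two apartments both contain simplices $\sigma$ and $\tau$, there is an isomorphism between these apartments fixing $\sigma$ and $\tau$ pointwise. Let $\operatorname{type}$ be a type function on $X$, i.e. a map from the vertices of $X$ to $\{0,\dots,n\}$ such that every $n$-dimensional simplex has exactly one vertex of each type; the type of a simplex is the set of the types of its vertices. Let $M=(m_{i,j})_{0\le i,j\le n}$ be the Coxeter matrix of $X$, indexed by types (so an apartment of $X$ is isomorphic, respecting types, to the Coxeter complex of $M$), and let $C=(c_{i,j})$ be its cosine matrix, $c_{i,j}=-\cos(\pi/m_{i,j})$, with $c_{i,j}=-1$ if $m_{i,j}=\infty$. Let $q\ge 2$ be a real number and assume that $X$ has thickness $\ge q+1$, i.e. every $(n-1)$-dimensional simplex of $X$ is contained in at least $q+1$ simplices of dimension $n$. Assume also that all $1$-dimensional links of $X$ (the links of the $(n-2)$-dimensional simplices) are finite. For $i\ne j$ let $\lambda_{i,j}=\lambda_{j,i}$ be the second largest eigenvalue,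 counted with multiplicity, of the simple random walk operator $\phi\mapsto \bigl(v\mapsto\frac1{d(v)}\sum_{u\sim v}\phi(u)\bigr)$ on the finite graph $X_\tau$, the link of a simplex $\tau$ of type $\{0,\dots,n\}\setminus\{i,j\}$; here one simplex $\tau$ is chosen for each unordered pair $\{i,j\}$, and the choice is arbitrary. Let $A=A(X)$ be the cosine matrix of $X$: the $(n+1)\times(n+1)$ matrix with $A_{i,i}=1$ and $A_{i,j}=-\lambda_{i,j}$ for $i\neq j$. Then, entrywise, $$A_{i,j}\;\ge\;\frac{2\sqrt q}{q+1}\,C_{i,j}+\Bigl(1-\frac{2\sqrt q}{q+1}\Bigr)I_{i,j}\qquad(0\le i,j\le n).$$ In particular, if the smallest eigenvalue $\widetilde\mu$ of $C$ satisfies $\widetilde\mu>1-\frac{q+1}{2\sqrt q}$, then $A$ is positive definite. -/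

import Mathlib

namespace BuildingCosine

/-! ### Simplicial complexes

A simplicial complex on a vertex universe `V` is a `PreAbstractSimplicialComplex V`: a set of
nonempty finite subsets of `V` (the simplices) closed under passing to nonempty subsets.  A simplex
with `k + 1` elements has dimension `k`. -/

/-- The vertices of a simplicial complex. -/
def vertices {V : Type*} (K : PreAbstractSimplicialComplex V) : Set V :=
  {v | {v} ∈ K.faces}

/-- The link of `σ`: all simplices `ρ` disjoint from `σ` such that `ρ ∪ σ` is a simplex. -/
def link {V : Type*} [DecidableEq V] (K : PreAbstractSimplicialComplex V) (σ : Finset V) :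
    PreAbstractSimplicialComplex V where
  faces := {ρ | ρ.Nonempty ∧ Disjoint ρ σ ∧ ρ ∪ σ ∈ K.faces}
  isRelLowerSet_faces := by
    rintro ρ ⟨hne, hd, hu⟩
    refine ⟨hne, fun ρ' hsub hne' => ⟨hne', Finset.disjoint_of_subset_left hsub hd, ?_⟩⟩
    exact (K.isRelLowerSet_faces hu).2 (Finset.union_subset_union_left hsub)
      (hne'.mono Finset.subset_union_left)

/-- The graph formed by the vertices and the edges (1-dimensional simplices) of a complex. -/
def skeletonGraph {V : Type*} [DecidableEq V] (K : PreAbstractSimplicialComplex V) :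
    SimpleGraph (vertices K) where
  Adj u v := u ≠ v ∧ ({u.1, v.1} : Finset V) ∈ K.faces
  symm := ⟨fun u v h => ⟨h.1.symm, by rw [Finset.pair_comm]; exact h.2⟩⟩
  loopless := ⟨fun _ h => h.1 rfl⟩

/-- `f` restricts to an isomorphism from the complex `K` onto the complex `L`: it is injective on
the vertices of `K`, and the simplices of `L` are exactly the images of the simplices of `K`
(values of `f` off the vertices of `K` are irrelevant). -/
def IsSimplicialIso {V W : Type*} (f : V → W) (K : PreAbstractSimplicialComplex V)
    (L : PreAbstractSimplicialComplex W) : Prop :=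
  Set.InjOn f (vertices K) ∧
    ∀ ρ : Finset W, ρ ∈ L.faces ↔ ∃ σ ∈ K.faces, f '' (σ : Set V) = (ρ : Set W)

/-- `t` is a type function on an `n`-dimensional complex: the sides `t ⁻¹' {i}`, `0 ≤ i ≤ n`,
make the complex `(n+1)`-partite, i.e. every `n`-dimensional simplex has exactly one vertex in each
side. The type of a simplex `σ` is then the set `t '' σ`. -/
def IsTypeFunction {V : Type*} {n : ℕ} (K : PreAbstractSimplicialComplex V)
    (t : V → Fin (n + 1)) : Prop :=
  ∀ σ ∈ K.faces, σ.card = n + 1 → ∀ i, ∃! v, v ∈ σ ∧ t v = i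

/-! ### Coxeter complexes and cosine matrices of Coxeter matrices

As in Mathlib, the value `0` in a Coxeter matrix stands for `∞`. -/

/-- The maximal proper standard parabolic subgroup generated by all simple reflections but `s`. -/
def maxParabolic {S : Type*} (M : CoxeterMatrix S) (s : S) : Subgroup M.Group :=
  Subgroup.closure (M.simple '' {s}ᶜ)

/-- The vertices of the Coxeter complex: the cosets `w W_{S \ {s}}`, with their type `s`. -/
abbrev CoxeterVertex {S : Type*} (M : CoxeterMatrix S) : Type _ :=
  Σ s : S, M.Group ⧸ maxParabolic M s

/-- The Coxeter complex `Σ(W, S)`: finitely many cosets `w W_{S \ {s}}` form a simplex if and only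
if they have a common element.  (The simplex with vertices `w W_{S \ {s}}`, `s ∉ J`, corresponds to
the standard coset `w W_J` and faces correspond to reverse inclusion of standard cosets.) -/
def coxeterComplex {S : Type*} (M : CoxeterMatrix S) :
    PreAbstractSimplicialComplex (CoxeterVertex M) where
  faces := {σ | σ.Nonempty ∧
    ∃ w : M.Group, ∀ v ∈ σ, v.2 = (QuotientGroup.mk w : M.Group ⧸ maxParabolic M v.1)}
  isRelLowerSet_faces := by
    rintro σ ⟨hne, w, hw⟩
    exact ⟨hne, fun τ hsub hne' => ⟨hne', w, fun v hv => hw v (hsub hv)⟩⟩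

/-- The cosine matrix of a Coxeter matrix: the entries are `-cos (π / m_{s,s'})`, and `-1` where
`m_{s,s'} = ∞`. -/
noncomputable def coxeterCosineMatrix {S : Type*} (M : CoxeterMatrix S) : Matrix S S ℝ :=
  fun s s' => if M s s' = 0 then -1 else -Real.cos (Real.pi / (M s s' : ℝ))

/-! ### Buildings -/

/-- An `n`-dimensional building, given with a system of apartments: a simplicial complex together
with a nonempty family of subcomplexes (apartments) such that
* each apartment is isomorphic to a Coxeter complex (of dimension `n`, i.e. of rank `n + 1`);
* any two simplices are contained in a common apartment;
* if two simplices `σ`, `τ` are contained in the apartments `K` and `L`, then some isomorphism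
  from `K` onto `L` fixes `σ` and `τ` pointwise. -/
structure Building (V : Type*) (n : ℕ) where
  complex : PreAbstractSimplicialComplex V
  apartments : Set (PreAbstractSimplicialComplex V)
  apartments_nonempty : apartments.Nonempty
  apartment_le : ∀ K ∈ apartments, K ≤ complex
  apartment_coxeter : ∀ K ∈ apartments, ∃ (M : CoxeterMatrix (Fin (n + 1)))
    (f : V → CoxeterVertex M), IsSimplicialIso f K (coxeterComplex M)
  exists_apartment : ∀ σ ∈ complex.faces, ∀ τ ∈ complex.faces,
    ∃ K ∈ apartments, σ ∈ K.faces ∧ τ ∈ K.faces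
  exists_iso : ∀ K ∈ apartments, ∀ L ∈ apartments, ∀ σ τ : Finset V,
    σ ∈ K.faces → τ ∈ K.faces → σ ∈ L.faces → τ ∈ L.faces →
    ∃ f : V → V, IsSimplicialIso f K L ∧ (∀ v ∈ σ, f v = v) ∧ (∀ v ∈ τ, f v = v)

/-- `M` is the Coxeter matrix of the building `X`, indexed according to the type function `t`: some
apartment is isomorphic to the Coxeter complex of `M` by an isomorphism that respects types. -/
def Building.HasCoxeterMatrix {V : Type*} {n : ℕ} (X : Building V n) (t : V → Fin (n + 1))
    (M : CoxeterMatrix (Fin (n + 1))) : Prop :=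
  ∃ K ∈ X.apartments, ∃ f : V → CoxeterVertex M,
    IsSimplicialIso f K (coxeterComplex M) ∧ ∀ v ∈ vertices K, (f v).1 = t v

/-- Thickness at least `k`: every simplex of dimension `n - 1` lies in at least `k` simplices of
dimension `n`. -/
def Building.ThicknessAtLeast {V : Type*} {n : ℕ} (X : Building V n) (k : ℝ) : Prop :=
  ∀ σ ∈ X.complex.faces, σ.card = n →
    ∃ T : Finset (Finset V), (∀ c ∈ T, c ∈ X.complex.faces ∧ c.card = n + 1 ∧ σ ⊆ c) ∧
      k ≤ (T.card : ℝ)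

/-- All 1-dimensional links, i.e. the links of the simplices of dimension `n - 2`, are finite. -/
def Building.FiniteOneDimLinks {V : Type*} [DecidableEq V] {n : ℕ} (X : Building V n) : Prop :=
  ∀ σ ∈ X.complex.faces, σ.card + 1 = n → (vertices (link X.complex σ)).Finite

/-! ### Simple random walks and the cosine matrix of a complex -/

/-- The simple random walk operator of a finite graph,
`(P φ) v = (1 / d(v)) ∑_{u ∼ v} φ u`. -/
noncomputable def walkOperator {W : Type*} [Fintype W] (G : SimpleGraph W) [DecidableRel G.Adj] :
    Module.End ℝ (W → ℝ) where
  toFun φ v := (1 / (G.degree v : ℝ)) * ∑ u ∈ G.neighborFinset v, φ u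
  map_add' φ ψ := by
    ext v
    simp [Finset.sum_add_distrib, mul_add]
  map_smul' a φ := by
    ext v
    simp only [Pi.smul_apply, smul_eq_mul, RingHom.id_apply, ← Finset.mul_sum]
    ring

/-- The second largest eigenvalue, counted with multiplicity, of the simple random walk on a finite
graph: the largest eigenvalue `μ` such that the eigenspaces for the eigenvalues `≥ μ` span a space
of dimension at least two.  (The operator is diagonalizable with real eigenvalues.) -/
noncomputable def secondEigenvalue {W : Type*} [Fintype W] (G : SimpleGraph W)
    [DecidableRel G.Adj] : ℝ :=
  sSup {μ : ℝ | (walkOperator G).HasEigenvalue μ ∧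
    2 ≤ Module.finrank ℝ
      ↥(⨆ ν ∈ Set.Ici μ, (walkOperator G).eigenspace ν : Submodule ℝ (W → ℝ))}

open Classical in
/-- The second largest eigenvalue of the simple random walk on the link of `τ`; it is only used
when that link is finite (the value `0` for infinite links is a dummy). -/
noncomputable def linkEigenvalue {V : Type*} [DecidableEq V] (K : PreAbstractSimplicialComplex V)
    (τ : Finset V) : ℝ :=
  if h : (vertices (link K τ)).Finite then
    haveI := h.fintype
    secondEigenvalue (skeletonGraph (link K τ))
  else 0

/-- `r` picks, for all `i ≠ j`, a simplex `r {i, j}` of type `{0, …, n} \ {i, j}`. -/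
def IsRepresentativeChoice {V : Type*} {n : ℕ} (K : PreAbstractSimplicialComplex V)
    (t : V → Fin (n + 1)) (r : Finset (Fin (n + 1)) → Finset V) : Prop :=
  ∀ i j, i ≠ j → r {i, j} ∈ K.faces ∧ t '' (r {i, j} : Set V) = {i, j}ᶜ

/-- The cosine matrix of an `n`-dimensional complex: `1` on the diagonal and `-λ_{i,j}` off the
diagonal, where `λ_{i,j}` is the second largest eigenvalue of the simple random walk on the link of
the chosen simplex `r {i, j}` of type `{0, …, n} \ {i, j}`. -/
noncomputable def cosineMatrix {V : Type*} [DecidableEq V] {n : ℕ}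
    (K : PreAbstractSimplicialComplex V) (r : Finset (Fin (n + 1)) → Finset V) :
    Matrix (Fin (n + 1)) (Fin (n + 1)) ℝ :=
  fun i j => if i = j then 1 else -linkEigenvalue K (r {i, j})

end BuildingCosine

namespace BuildingCosine

open CoxeterSystem

section ReflectionAction

variable {S W : Type*} [Group W] {M : CoxeterMatrix S} (cs : CoxeterSystem M W)

open Classical in
/-- The action of a simple reflection on pairs of a group element and a sign: it conjugates the
element, and changes the sign exactly at the simple reflection itself. -/
noncomputable def signedConj (i : S) : Function.End (W × ZMod 2) :=
  fun x => (cs.simple i * x.1 * cs.simple i, x.2 + if x.1 = cs.simple i then 1 else 0)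

lemma simple_mul_pow_simple_mul_simple (i j : S) (l : ℕ) :
    cs.simple j * (cs.simple i * cs.simple j) ^ l
      = ((cs.simple i * cs.simple j) ^ l)⁻¹ * cs.simple j := by
  induction l with
  | zero => simp
  | succ l ih =>
    rw [pow_succ, ← mul_assoc, ih]
    simp [mul_assoc, ← pow_succ, pow_succ']

open Classical in
lemma signedConj_mul_pow (i j : S) (k : ℕ) (x : W × ZMod 2) :
    ((signedConj cs i * signedConj cs j) ^ k) x =
      ((cs.simple i * cs.simple j) ^ k * x.1 * ((cs.simple i * cs.simple j) ^ k)⁻¹,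
        x.2 + ∑ p ∈ Finset.range (2 * k),
          if x.1 = cs.simple j * (cs.simple i * cs.simple j) ^ p then 1 else 0) := by
  induction k with
  | zero => simp [Function.End.one_def]
  | succ k ih =>
    rw [pow_succ']
    change signedConj cs i (signedConj cs j (((signedConj cs i * signedConj cs j) ^ k) x)) = _
    rw [ih]
    set r := cs.simple i * cs.simple j with hr
    have h1 : (r ^ k * x.1 * (r ^ k)⁻¹ = cs.simple j) ↔ x.1 = cs.simple j * r ^ (2 * k) := by
      have e : cs.simple j * r ^ (2 * k) = (r ^ k)⁻¹ * (cs.simple j * r ^ k) := by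
        have e0 := simple_mul_pow_simple_mul_simple cs i j k
        rw [← hr] at e0
        rw [two_mul, pow_add, ← mul_assoc, ← mul_assoc, e0]
      rw [e, mul_inv_eq_iff_eq_mul, eq_inv_mul_iff_mul_eq]
    have h2 : (cs.simple j * (r ^ k * x.1 * (r ^ k)⁻¹) * cs.simple j = cs.simple i) ↔
        x.1 = cs.simple j * r ^ (2 * k + 1) := by
      have e : cs.simple j * r ^ (2 * k + 1)
          = (r ^ k)⁻¹ * (cs.simple j * (cs.simple i * cs.simple j)) * r ^ k := by
        rw [show 2 * k + 1 = k + (1 + k) by ring, pow_add, ← mul_assoc,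
          simple_mul_pow_simple_mul_simple, ← hr, pow_add, pow_one]
        simp [mul_assoc]
      rw [e]
      constructor
      · intro h
        have : x.1 = (r ^ k)⁻¹ * (cs.simple j * (cs.simple j * (r ^ k * x.1 * (r ^ k)⁻¹) *
            cs.simple j) * cs.simple j) * r ^ k := by
          simp [mul_assoc]
        rw [this, h]; simp [mul_assoc]
      · intro h
        rw [h]; simp [mul_assoc]
    rw [show 2 * (k + 1) = 2 * k + 1 + 1 by ring, Finset.sum_range_succ, Finset.sum_range_succ]
    simp only [signedConj, h1, h2]
    refine Prod.ext ?_ ?_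
    · simp only [hr, pow_succ', mul_inv_rev, inv_simple, mul_assoc]
    · simp only [add_assoc]

lemma isLiftable_signedConj : M.IsLiftable (signedConj cs) := by
  classical
  intro i j
  funext x
  rw [signedConj_mul_pow, cs.simple_mul_simple_pow, two_mul, Finset.sum_range_add]
  simp only [pow_add, cs.simple_mul_simple_pow, one_mul]
  rw [CharTwo.add_self_eq_zero]
  simp [Function.End.one_def]

/-- The action of a Coxeter group on pairs of a group element and a sign which counts inversions
modulo two. -/
noncomputable def reflectionAction : W →* Function.End (W × ZMod 2) :=
  cs.lift ⟨signedConj cs, isLiftable_signedConj cs⟩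

lemma reflectionAction_simple (i : S) : reflectionAction cs (cs.simple i) = signedConj cs i :=
  cs.lift_apply_simple _ i

lemma reflectionAction_mul (w w' : W) (x : W × ZMod 2) :
    reflectionAction cs (w * w') x = reflectionAction cs w (reflectionAction cs w' x) := by
  rw [map_mul]; rfl

lemma reflectionAction_fst (w : W) (x : W × ZMod 2) :
    (reflectionAction cs w x).1 = w * x.1 * w⁻¹ := by
  induction w using cs.simple_induction_left generalizing x with
  | one => simp [Function.End.one_def]
  | mul_simple_left w i ih =>
    rw [reflectionAction_mul, reflectionAction_simple]
    simp [signedConj, ih, mul_assoc]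

lemma exists_word_of_reflectionAction_ne (ω : List S) (x : W × ZMod 2)
    (h : (reflectionAction cs (cs.wordProd ω) x).2 ≠ x.2) :
    ∃ ω' : List S, ω'.length + 1 = ω.length ∧ cs.wordProd ω * x.1 = cs.wordProd ω' := by
  induction ω with
  | nil => simp [Function.End.one_def] at h
  | cons a ω ih =>
    by_cases h' : (reflectionAction cs (cs.wordProd ω) x).2 = x.2
    · rw [cs.wordProd_cons, reflectionAction_mul, reflectionAction_simple] at h
      refine ⟨ω, rfl, ?_⟩
      by_cases ht : (reflectionAction cs (cs.wordProd ω) x).1 = cs.simple a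
      · rw [reflectionAction_fst, mul_inv_eq_iff_eq_mul] at ht
        rw [cs.wordProd_cons, mul_assoc, ht, cs.simple_mul_simple_cancel_left]
      · simp [signedConj, ht, h'] at h
    · obtain ⟨ω', hl, hp⟩ := ih h'
      exact ⟨a :: ω', by simp [hl], by rw [cs.wordProd_cons, mul_assoc, hp, cs.wordProd_cons]⟩

lemma reflectionAction_of_isRightDescent {w : W} {k : S} (h : cs.IsRightDescent w k) (ε : ZMod 2) :
    (reflectionAction cs w (cs.simple k, ε)).2 ≠ ε := by
  set w' := w * cs.simple k with hw'
  have hw : w = w' * cs.simple k := by simp [hw']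
  rw [hw, reflectionAction_mul, reflectionAction_simple]
  have e : signedConj cs k (cs.simple k, ε) = (cs.simple k, ε + 1) := by simp [signedConj]
  rw [e]
  by_cases h2 : (reflectionAction cs w' (cs.simple k, ε + 1)).2 = ε + 1
  · rw [h2]; simp
  · exfalso
    obtain ⟨ω, hω, hωw⟩ := cs.exists_isReduced w'
    obtain ⟨ω', hl, hp⟩ := exists_word_of_reflectionAction_ne cs ω (cs.simple k, ε + 1)
      (by rw [← hωw]; exact h2)
    rw [← hωw] at hp
    simp only [← hw] at hp
    have h3 : cs.length w ≤ ω'.length := by rw [hp]; exact cs.length_wordProd_le _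
    have h4 : cs.length w' = ω.length := by rw [hωw]; exact hω
    have h5 : cs.length w' < cs.length w := h
    omega

lemma mem_of_reflectionAction_ne {I : Set S} {w : W}
    (hw : w ∈ Subgroup.closure (cs.simple '' I)) (x : W × ZMod 2)
    (h : (reflectionAction cs w x).2 ≠ x.2) : x.1 ∈ Subgroup.closure (cs.simple '' I) := by
  induction hw using Subgroup.closure_induction generalizing x with
  | mem y hy =>
    obtain ⟨i, hi, rfl⟩ := hy
    by_cases ht : x.1 = cs.simple i
    · rw [ht]; exact Subgroup.subset_closure ⟨i, hi, rfl⟩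
    · simp [reflectionAction_simple, signedConj, ht] at h
  | one => simp [Function.End.one_def] at h
  | mul u v hu hv ihu ihv =>
    by_cases h' : (reflectionAction cs v x).2 = x.2
    · rw [reflectionAction_mul] at h
      have := ihu (reflectionAction cs v x) (by rwa [h'])
      rw [reflectionAction_fst] at this
      simpa [mul_assoc] using mul_mem (mul_mem (inv_mem hv) this) hv
    · exact ihv x h'
  | inv u hu ih =>
    have e : reflectionAction cs u (reflectionAction cs u⁻¹ x) = x := by
      rw [← reflectionAction_mul]; simp [Function.End.one_def]
    have := ih (reflectionAction cs u⁻¹ x) (by rw [e]; exact h.symm)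
    rw [reflectionAction_fst] at this
    simpa [mul_assoc] using mul_mem (mul_mem hu this) (inv_mem hu)

/-- If no simple reflection lies in the complementary maximal parabolic subgroup, then every
parabolic subgroup is the intersection of the maximal ones containing it. -/
lemma mem_closure_of_forall_mem
    (hind : ∀ k, cs.simple k ∉ Subgroup.closure (cs.simple '' {k}ᶜ)) {J : Set S} {w : W}
    (hw : ∀ s ∉ J, w ∈ Subgroup.closure (cs.simple '' {s}ᶜ)) :
    w ∈ Subgroup.closure (cs.simple '' J) := by
  induction hl : cs.length w using Nat.strong_induction_on generalizing w with
  | _ N ih =>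
    by_cases h1 : w = 1
    · rw [h1]; exact one_mem _
    obtain ⟨k, hk⟩ := cs.exists_rightDescent_of_ne_one h1
    have hmem : ∀ s ∉ J, cs.simple k ∈ Subgroup.closure (cs.simple '' {s}ᶜ) := fun s hs =>
      mem_of_reflectionAction_ne cs (hw s hs) (cs.simple k, 0)
        (reflectionAction_of_isRightDescent cs hk 0)
    have hkJ : k ∈ J := by
      by_contra hkJ
      exact hind k (hmem k hkJ)
    have := ih _ (hl ▸ hk) (w := w * cs.simple k)
      (fun s hs => mul_mem (hw s hs) (hmem s hs)) rfl
    have h2 := mul_mem this (Subgroup.subset_closure (Set.mem_image_of_mem cs.simple hkJ))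
    simpa using h2

end ReflectionAction

/-- A set of vertices is the vertex set of a simplex. -/
def IsFace {V : Type*} (K : PreAbstractSimplicialComplex V) (A : Set V) : Prop :=
  ∃ ρ ∈ K.faces, (ρ : Set V) = A

/-- The bi-infinite sequence `p` winds around the link of `τ` in `K`, which is a cycle of length
`2 * m` (a bi-infinite path if `m = 0`). -/
structure IsLinkCycle {V : Type*} (K : PreAbstractSimplicialComplex V) (τ : Set V) (m : ℕ)
    (p : ℤ → V) : Prop where
  eq_iff : ∀ k l, p k = p l ↔ (2 * m : ℤ) ∣ k - l
  notMem : ∀ k, p k ∉ τ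
  face : ∀ k, IsFace K ({p k, p (k + 1)} ∪ τ)
  exists_eq : ∀ x, x ∉ τ → IsFace K ({x} ∪ τ) → ∃ k, x = p k
  exists_edge : ∀ x y, x ∉ τ → y ∉ τ → x ≠ y → IsFace K ({x, y} ∪ τ) →
    ∃ k, (x = p k ∧ y = p (k + 1)) ∨ (x = p (k + 1) ∧ y = p k)

section CoxeterComplex

variable {S : Type*} (M : CoxeterMatrix S)

/-- No simple reflection lies in the maximal parabolic subgroup generated by the other ones. -/
def SimpleIndep : Prop := ∀ k, M.simple k ∉ maxParabolic M k

/-- The vertex `w W_{S \ {s}}` of the Coxeter complex. -/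
def cosetVertex (w : M.Group) (s : S) : CoxeterVertex M := ⟨s, QuotientGroup.mk w⟩

variable {M}

lemma simple_mul_self (i : S) : M.simple i * M.simple i = 1 :=
  M.toCoxeterSystem.simple_mul_simple_self i

lemma simple_inv (i : S) : (M.simple i)⁻¹ = M.simple i :=
  M.toCoxeterSystem.inv_simple i

lemma simple_mem_maxParabolic {i s : S} (h : i ≠ s) : M.simple i ∈ maxParabolic M s :=
  Subgroup.subset_closure ⟨i, h, rfl⟩

lemma cosetVertex_eq_iff {w w' : M.Group} {s : S} :
    cosetVertex M w s = cosetVertex M w' s ↔ w⁻¹ * w' ∈ maxParabolic M s := by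
  unfold cosetVertex
  rw [Sigma.mk.injEq]
  simp [QuotientGroup.eq]

lemma cosetVertex_mul {w u : M.Group} {s : S} (hu : u ∈ maxParabolic M s) :
    cosetVertex M (w * u) s = cosetVertex M w s := by
  rw [eq_comm, cosetVertex_eq_iff]; simpa using hu

lemma exists_cosetVertex (v : CoxeterVertex M) : ∃ w, v = cosetVertex M w v.1 := by
  obtain ⟨s, q⟩ := v
  obtain ⟨w, rfl⟩ := QuotientGroup.mk_surjective q
  exact ⟨w, rfl⟩

lemma isFace_coxeterComplex [Finite S] {A : Set (CoxeterVertex M)} :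
    IsFace (coxeterComplex M) A ↔ A.Nonempty ∧ ∃ w, ∀ v ∈ A, v = cosetVertex M w v.1 := by
  have key : ∀ (w : M.Group) (v : CoxeterVertex M),
      v = cosetVertex M w v.1 ↔ v.2 = (QuotientGroup.mk w : M.Group ⧸ maxParabolic M v.1) := by
    rintro w ⟨s, q⟩
    simp [cosetVertex]
  constructor
  · rintro ⟨ρ, ⟨hne, w, hw⟩, rfl⟩
    exact ⟨by simpa using hne, w, fun v hv => (key w v).2 (hw v hv)⟩
  · rintro ⟨hne, w, hw⟩
    have hfin : A.Finite := (Set.finite_range (cosetVertex M w)).subset fun v hv =>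
      ⟨v.1, (hw v hv).symm⟩
    refine ⟨hfin.toFinset, ⟨by simpa using hne, w, fun v hv => (key w v).1 (hw v (by simpa using hv))⟩,
      by simp⟩

lemma SimpleIndep.mem_closure (h : SimpleIndep M) {J : Set S} {w : M.Group}
    (hw : ∀ s ∉ J, w ∈ maxParabolic M s) : w ∈ Subgroup.closure (M.simple '' J) :=
  mem_closure_of_forall_mem M.toCoxeterSystem h hw

lemma mem_closure_pair {i j : S} {u : M.Group}
    (hu : u ∈ Subgroup.closure (M.simple '' {i, j})) :
    ∃ l : ℤ, u = (M.simple i * M.simple j) ^ l ∨ u = (M.simple i * M.simple j) ^ l * M.simple i := by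
  have step : ∀ x y, y ∈ M.simple '' {i, j} →
      (∃ l : ℤ, x = (M.simple i * M.simple j) ^ l ∨
        x = (M.simple i * M.simple j) ^ l * M.simple i) →
      (∃ l : ℤ, x * y = (M.simple i * M.simple j) ^ l ∨
        x * y = (M.simple i * M.simple j) ^ l * M.simple i) := by
    rintro x y ⟨a, ha, rfl⟩ ⟨l, rfl | rfl⟩
    · rcases ha with rfl | rfl
      · exact ⟨l, Or.inr rfl⟩
      · refine ⟨l - 1, Or.inr ?_⟩
        rw [zpow_sub_one]
        simp [simple_inv, mul_assoc, simple_mul_self]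
    · rcases ha with rfl | rfl
      · exact ⟨l, Or.inl (by rw [mul_assoc, simple_mul_self, mul_one])⟩
      · exact ⟨l + 1, Or.inl (by rw [mul_assoc, zpow_add_one])⟩
  induction hu using Subgroup.closure_induction_right with
  | one => exact ⟨0, by simp⟩
  | mul_right x hx y hy ih => exact step x y hy ih
  | mul_inv_cancel x hx y hy ih =>
    have : y⁻¹ ∈ M.simple '' {i, j} := by
      obtain ⟨a, ha, rfl⟩ := hy
      exact ⟨a, ha, (simple_inv a).symm⟩
    exact step x _ this ih

lemma zpow_simple_mul_simple_mem {i j s : S} (hi : s ≠ i) (hj : s ≠ j) (l : ℤ) :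
    (M.simple i * M.simple j) ^ l ∈ maxParabolic M s :=
  zpow_mem (mul_mem (simple_mem_maxParabolic hi.symm) (simple_mem_maxParabolic hj.symm)) l

lemma SimpleIndep.zpow_eq_one (h : SimpleIndep M) {i j : S} {l : ℤ} {a b : S}
    (hab : (a = i ∧ b = j) ∨ (a = j ∧ b = i))
    (hl : (M.simple i * M.simple j) ^ l ∈ maxParabolic M a) :
    (M.simple i * M.simple j) ^ l = 1 := by
  have h1 : (M.simple i * M.simple j) ^ l ∈ Subgroup.closure (M.simple '' {b}) := by
    refine h.mem_closure fun s hs => ?_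
    by_cases hsa : s = a
    · rwa [hsa]
    · refine zpow_simple_mul_simple_mem ?_ ?_ l <;>
        rcases hab with ⟨rfl, rfl⟩ | ⟨rfl, rfl⟩ <;> first | exact hsa | exact hs
  rw [Set.image_singleton, Subgroup.mem_closure_singleton] at h1
  obtain ⟨k, hk⟩ := h1
  have par := congrArg M.toCoxeterSystem.lengthParity hk
  have hs : ∀ a, M.toCoxeterSystem.lengthParity (M.simple a) = Multiplicative.ofAdd 1 :=
    M.toCoxeterSystem.lengthParity_simple
  rw [map_zpow, map_zpow, map_mul, hs, hs, hs] at par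
  rcases Int.even_or_odd' k with ⟨c, rfl | rfl⟩
  · rw [← hk, zpow_mul, show (2 : ℤ) = 1 + 1 by rfl, zpow_add, zpow_one, simple_mul_self,
      one_zpow]
  · exfalso
    have e : (Multiplicative.ofAdd (1 : ZMod 2)) * Multiplicative.ofAdd (1 : ZMod 2) = 1 := rfl
    rw [e, one_zpow, zpow_add, zpow_mul, zpow_one, show (2 : ℤ) = 1 + 1 by rfl, zpow_add, zpow_one,
      e, one_zpow, one_mul] at par
    exact absurd par (by decide)

/-- The sequence of vertices winding around the link of a simplex of cotype `{i, j}` in the Coxeter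
complex. -/
def linkSeq (w : M.Group) (i j : S) (k : ℤ) : CoxeterVertex M :=
  cosetVertex M (w * (M.simple i * M.simple j) ^ (k / 2)) (if k % 2 = 0 then i else j)

lemma linkSeq_even (w : M.Group) (i j : S) (l : ℤ) :
    linkSeq w i j (2 * l) = cosetVertex M (w * (M.simple i * M.simple j) ^ l) i := by
  unfold linkSeq
  rw [if_pos (by omega), show 2 * l / 2 = l by omega]

lemma linkSeq_odd (w : M.Group) (i j : S) (l : ℤ) :
    linkSeq w i j (2 * l + 1) = cosetVertex M (w * (M.simple i * M.simple j) ^ l) j := by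
  unfold linkSeq
  rw [if_neg (by omega), show (2 * l + 1) / 2 = l by omega]

lemma exists_cosetVertex_linkSeq (w : M.Group) {i j : S} (hij : i ≠ j) (k : ℤ) :
    ∃ u ∈ Subgroup.closure (M.simple '' {i, j}),
      ∀ x ∈ ({linkSeq w i j k, linkSeq w i j (k + 1)} : Set _),
        x = cosetVertex M (w * u) x.1 := by
  have hi : M.simple i ∈ Subgroup.closure (M.simple '' {i, j}) :=
    Subgroup.subset_closure ⟨i, by simp, rfl⟩
  have hj : M.simple j ∈ Subgroup.closure (M.simple '' {i, j}) :=
    Subgroup.subset_closure ⟨j, by simp, rfl⟩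
  rcases Int.even_or_odd' k with ⟨l, rfl | rfl⟩
  · refine ⟨(M.simple i * M.simple j) ^ l, zpow_mem (mul_mem hi hj) l, ?_⟩
    rintro x (rfl | rfl)
    · rw [linkSeq_even]; rfl
    · rw [linkSeq_odd]; rfl
  · refine ⟨(M.simple i * M.simple j) ^ l * M.simple i,
      mul_mem (zpow_mem (mul_mem hi hj) l) hi, ?_⟩
    rintro x (rfl | rfl)
    · rw [linkSeq_odd, ← mul_assoc]
      exact (cosetVertex_mul (simple_mem_maxParabolic hij)).symm
    · rw [show 2 * l + 1 + 1 = 2 * (l + 1) by ring, linkSeq_even, zpow_add_one, ← mul_assoc,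
        ← mul_assoc, ← mul_assoc]
      exact cosetVertex_mul (simple_mem_maxParabolic hij.symm)

lemma exists_linkSeq_eq (w : M.Group) {i j : S} (hij : i ≠ j) {u : M.Group}
    (hu : u ∈ Subgroup.closure (M.simple '' {i, j})) :
    ∃ k, (cosetVertex M (w * u) i = linkSeq w i j k ∧
        cosetVertex M (w * u) j = linkSeq w i j (k + 1)) ∨
      (cosetVertex M (w * u) i = linkSeq w i j (k + 1) ∧
        cosetVertex M (w * u) j = linkSeq w i j k) := by
  obtain ⟨l, rfl | rfl⟩ := mem_closure_pair hu
  · exact ⟨2 * l, Or.inl ⟨(linkSeq_even ..).symm, (linkSeq_odd ..).symm⟩⟩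
  · refine ⟨2 * l + 1, Or.inr ⟨?_, ?_⟩⟩
    · rw [show 2 * l + 1 + 1 = 2 * (l + 1) by ring, linkSeq_even, zpow_add_one, ← mul_assoc,
        ← mul_assoc, ← mul_assoc]
      exact (cosetVertex_mul (simple_mem_maxParabolic hij.symm)).symm
    · rw [linkSeq_odd, ← mul_assoc]
      exact cosetVertex_mul (simple_mem_maxParabolic hij)

lemma closure_pair_le {i j s : S} (hi : s ≠ i) (hj : s ≠ j) :
    Subgroup.closure (M.simple '' {i, j}) ≤ maxParabolic M s := by
  rw [Subgroup.closure_le]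
  rintro _ ⟨a, rfl | rfl, rfl⟩
  · exact simple_mem_maxParabolic hi.symm
  · exact simple_mem_maxParabolic hj.symm

/-- The link of a simplex of cotype `{i, j}` in the Coxeter complex is a cycle whose length is twice
the order of the product of the two simple reflections. -/
theorem isLinkCycle_linkSeq [Finite S] (h : SimpleIndep M) (w : M.Group) {i j : S} (hij : i ≠ j) :
    IsLinkCycle (coxeterComplex M) (cosetVertex M w '' {i, j}ᶜ)
      (orderOf (M.simple i * M.simple j)) (linkSeq w i j) := by
  have hpair : ∀ A : Set (CoxeterVertex M), IsFace (coxeterComplex M)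
      (A ∪ cosetVertex M w '' {i, j}ᶜ) → ∃ u ∈ Subgroup.closure (M.simple '' {i, j}),
        ∀ x ∈ A, x ∉ cosetVertex M w '' {i, j}ᶜ →
          x = cosetVertex M (w * u) i ∨ x = cosetVertex M (w * u) j := by
    intro A hA
    obtain ⟨-, u, hu⟩ := isFace_coxeterComplex.1 hA
    have huw : ∀ s ∉ ({i, j} : Set S), cosetVertex M w s = cosetVertex M u s := fun s hs =>
      hu (cosetVertex M w s) (Or.inr ⟨s, hs, rfl⟩)
    refine ⟨w⁻¹ * u, h.mem_closure fun s hs => cosetVertex_eq_iff.1 (huw s hs), ?_⟩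
    intro x hx hxn
    have e := hu x (Or.inl hx)
    rw [mul_inv_cancel_left]
    by_cases hxi : x.1 ∈ ({i, j} : Set S)
    · rcases hxi with hxi | hxi
      · left; rwa [hxi] at e
      · right; rwa [hxi] at e
    · exact absurd ⟨x.1, hxi, (huw _ hxi).trans e.symm⟩ hxn
  have htype : ∀ k, (linkSeq w i j k).1 = i ∨ (linkSeq w i j k).1 = j := by
    intro k
    unfold linkSeq cosetVertex
    by_cases hk : k % 2 = 0
    · left; simp [hk]
    · right; simp [hk]
  refine ⟨?_, ?_, ?_, ?_, ?_⟩
  · have hne : ∀ a b, linkSeq w i j (2 * a) ≠ linkSeq w i j (2 * b + 1) := by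
      intro a b hab
      rw [linkSeq_even, linkSeq_odd] at hab
      exact hij (congrArg Sigma.fst hab)
    have hdvd : ∀ (s t : S) (_ : (s = i ∧ t = j) ∨ (s = j ∧ t = i)) (a b : ℤ),
        cosetVertex M (w * (M.simple i * M.simple j) ^ a) s =
          cosetVertex M (w * (M.simple i * M.simple j) ^ b) s ↔
          (2 * orderOf (M.simple i * M.simple j) : ℤ) ∣ 2 * a - 2 * b := by
      intro s t hst a b
      rw [← mul_sub, mul_dvd_mul_iff_left (by norm_num), orderOf_dvd_iff_zpow_eq_one, eq_comm,
        cosetVertex_eq_iff]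
      have e : (w * (M.simple i * M.simple j) ^ b)⁻¹ * (w * (M.simple i * M.simple j) ^ a)
          = (M.simple i * M.simple j) ^ (a - b) := by
        rw [mul_inv_rev, mul_assoc, inv_mul_cancel_left, ← zpow_neg, ← zpow_add]
        congr 1; ring
      rw [e]
      refine ⟨fun hm => h.zpow_eq_one hst hm, fun h1 => ?_⟩
      rw [h1]; exact one_mem _
    intro k l
    rcases Int.even_or_odd' k with ⟨a, rfl | rfl⟩ <;>
      rcases Int.even_or_odd' l with ⟨b, rfl | rfl⟩
    · rw [linkSeq_even, linkSeq_even]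
      exact hdvd i j (Or.inl ⟨rfl, rfl⟩) a b
    · refine iff_of_false (hne a b) fun hd => ?_
      have := (Dvd.intro _ rfl : (2 : ℤ) ∣ _).trans hd
      omega
    · refine iff_of_false (hne b a).symm fun hd => ?_
      have := (Dvd.intro _ rfl : (2 : ℤ) ∣ _).trans hd
      omega
    · rw [linkSeq_odd, linkSeq_odd, add_sub_add_right_eq_sub]
      exact hdvd j i (Or.inr ⟨rfl, rfl⟩) a b
  · rintro k ⟨s, hs, hk⟩
    have := congrArg Sigma.fst hk
    rcases htype k with h1 | h1 <;> rw [h1] at this <;> exact hs (by simp [← this, cosetVertex])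
  · intro k
    obtain ⟨u, hu, hx⟩ := exists_cosetVertex_linkSeq w hij k
    refine isFace_coxeterComplex.2 ⟨⟨linkSeq w i j k, by simp⟩, w * u, ?_⟩
    rintro v (hv | ⟨s, hs, rfl⟩)
    · exact hx v hv
    · simp only [Set.mem_compl_iff, Set.mem_insert_iff, Set.mem_singleton_iff, not_or] at hs
      exact (cosetVertex_mul (closure_pair_le hs.1 hs.2 hu)).symm
  · intro x hx hf
    obtain ⟨u, hu, hA⟩ := hpair _ hf
    obtain ⟨k, hk⟩ := exists_linkSeq_eq w hij hu
    rcases hA x rfl hx with rfl | rfl <;> rcases hk with hk | hk <;>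
      first | exact ⟨_, hk.1⟩ | exact ⟨_, hk.2⟩
  · intro x y hx hy hxy hf
    obtain ⟨u, hu, hA⟩ := hpair _ hf
    obtain ⟨k, hk⟩ := exists_linkSeq_eq w hij hu
    refine ⟨k, ?_⟩
    rcases hA x (by simp) hx with rfl | rfl <;> rcases hA y (by simp) hy with rfl | rfl
    · exact absurd rfl hxy
    · exact hk
    · exact hk.symm.imp And.symm And.symm
    · exact absurd rfl hxy

end CoxeterComplex

/-- A sequence vanishing at `0` and `N` which is subharmonic-like for a tridiagonal recursion is
controlled by the largest eigenvalue `2 √β cos (π / N)` of the recursion. -/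
lemma le_two_mul_sqrt_mul_cos {N : ℕ} {μ β : ℝ} (hβ : 0 < β) (e : ℕ → ℝ) (h0 : e 0 = 0)
    (hN : e N = 0)
    (h : ∀ k, k + 1 < N → μ * |e (k + 1)| ≤ |e (k + 2)| + β * |e k|)
    (hne : ∃ k < N, e k ≠ 0) : μ ≤ 2 * √β * Real.cos (Real.pi / N) := by
  obtain ⟨k₁, hk₁, hek₁⟩ := hne
  have hNpos : 0 < N := by omega
  have hNr : (0 : ℝ) < N := by exact_mod_cast hNpos
  set x : ℝ := Real.pi / N with hx
  set w : ℕ → ℝ := fun k => √β ^ k * Real.sin (k * x) with hw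
  have hsβ : 0 < √β := Real.sqrt_pos.2 hβ
  have hwpos : ∀ k, 0 < k → k < N → 0 < w k := by
    intro k hk hkN
    have hk' : (0 : ℝ) < k := by exact_mod_cast hk
    have hkN' : (k : ℝ) < N := by exact_mod_cast hkN
    refine mul_pos (pow_pos hsβ k) (Real.sin_pos_of_pos_of_lt_pi ?_ ?_)
    · exact mul_pos hk' (div_pos Real.pi_pos hNr)
    · rw [hx, ← mul_div_assoc, div_lt_iff₀ hNr, mul_comm]
      exact mul_lt_mul_of_pos_left hkN' Real.pi_pos
  have hw0 : w 0 = 0 := by simp [hw]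
  have hwN : w N = 0 := by simp [hw, hx, mul_div_cancel₀ _ hNr.ne']
  have hrec : ∀ k, w (k + 2) + β * w k = 2 * √β * Real.cos x * w (k + 1) := by
    intro k
    simp only [hw]
    have e1 : ((k + 2 : ℕ) : ℝ) * x = ((k + 1 : ℕ) : ℝ) * x + x := by push_cast; ring
    have e2 : (k : ℝ) * x = ((k + 1 : ℕ) : ℝ) * x - x := by push_cast; ring
    rw [e1, e2, Real.sin_add, Real.sin_sub]
    have e3 : β = √β ^ 2 := (Real.sq_sqrt hβ.le).symm
    nth_rw 2 [e3]
    ring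
  have hmem : k₁ ∈ Finset.Ioo 0 N := by
    rw [Finset.mem_Ioo]
    refine ⟨Nat.pos_of_ne_zero ?_, hk₁⟩
    rintro rfl
    exact hek₁ h0
  obtain ⟨k₀, hk₀, hmax⟩ := Finset.exists_max_image (Finset.Ioo 0 N) (fun k => |e k| / w k)
    ⟨k₁, hmem⟩
  rw [Finset.mem_Ioo] at hk₀ hmem
  set R := |e k₀| / w k₀ with hR
  have hRpos : 0 < R := lt_of_lt_of_le
    (div_pos (abs_pos.2 hek₁) (hwpos _ hmem.1 hmem.2)) (hmax k₁ (Finset.mem_Ioo.2 hmem))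
  have hle : ∀ k ≤ N, |e k| ≤ R * w k := by
    intro k hk
    rcases Nat.eq_zero_or_pos k with rfl | hk0
    · simp [h0, hw0]
    rcases hk.eq_or_lt with rfl | hkN
    · simp [hN, hwN]
    · exact (div_le_iff₀ (hwpos k hk0 hkN)).1 (hmax k (Finset.mem_Ioo.2 ⟨hk0, hkN⟩))
  obtain ⟨j, rfl⟩ : ∃ j, k₀ = j + 1 := ⟨k₀ - 1, by omega⟩
  have hwj := hwpos _ hk₀.1 hk₀.2
  have hej : |e (j + 1)| = R * w (j + 1) := by rw [hR, div_mul_cancel₀ _ hwj.ne']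
  have h1 := h j hk₀.2
  have h2 := hle (j + 2) (by omega)
  have h3 := hle j (by omega)
  have h4 : μ * (R * w (j + 1)) ≤ 2 * √β * Real.cos x * (R * w (j + 1)) := by
    calc μ * (R * w (j + 1)) ≤ |e (j + 2)| + β * |e j| := by rw [← hej]; exact h1
      _ ≤ R * w (j + 2) + β * (R * w j) := by gcongr
      _ = R * (w (j + 2) + β * w j) := by ring
      _ = _ := by rw [hrec]; ring
  exact le_of_mul_le_mul_right h4 (mul_pos hRpos hwj)

/-- A generalized `m`-gon, as a graph: the diameter is at most `m`, the graph is bipartite, and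
vertices at distance less than `m` are joined by a unique geodesic. -/
structure IsGenPolygon {W : Type*} (G : SimpleGraph W) (m : ℕ) : Prop where
  connected : G.Connected
  dist_le : ∀ a x, G.dist a x ≤ m
  dist_adj : ∀ a x y, G.Adj x y → G.dist a y = G.dist a x + 1 ∨ G.dist a x = G.dist a y + 1
  unique : ∀ a x y y' k, k + 1 < m → G.dist a x = k + 1 → G.Adj x y → G.Adj x y' →
    G.dist a y = k → G.dist a y' = k → y = y'

namespace IsGenPolygon

variable {W : Type*} {G : SimpleGraph W} {m : ℕ} (hG : IsGenPolygon G m)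
include hG

lemma exists_pred {a x : W} {k : ℕ} (h : G.dist a x = k + 1) :
    ∃ y, G.Adj x y ∧ G.dist a y = k := by
  obtain ⟨p, hp⟩ := hG.connected.exists_walk_length_eq_dist x a
  rw [SimpleGraph.dist_comm, h] at hp
  cases p with
  | nil => simp at hp
  | @cons _ y _ hxy p =>
    refine ⟨y, hxy, ?_⟩
    have h1 : G.dist a y ≤ k := by
      rw [SimpleGraph.dist_comm]
      exact (SimpleGraph.dist_le p).trans (by simpa using hp.le)
    rcases hG.dist_adj a x y hxy with h2 | h2 <;> omega

variable [Fintype W] [DecidableRel G.Adj]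

lemma degree_le_of_opposite (hm : 2 ≤ m) {x z : W} (h : G.dist x z = m) :
    G.degree x ≤ G.degree z := by
  obtain ⟨k, rfl⟩ : ∃ k, m = k + 2 := ⟨m - 2, by omega⟩
  have hy : ∀ y, G.Adj x y → ∃ y', G.Adj z y' ∧ G.dist y y' = k := by
    intro y hxy
    apply hG.exists_pred
    have h1 := hG.dist_adj z x y hxy
    have h2 := hG.dist_le z y
    rw [G.dist_comm (u := z) (v := x), h] at h1
    rw [SimpleGraph.dist_comm]
    omega
  choose! f hf hfd using hy
  rw [← G.card_neighborFinset_eq_degree, ← G.card_neighborFinset_eq_degree]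
  refine Finset.card_le_card_of_injOn f (fun y hxy => ?_) ?_
  · simp only [Finset.mem_coe, SimpleGraph.mem_neighborFinset] at hxy ⊢
    exact hf y hxy
  · intro y₁ h₁ y₂ h₂ he
    simp only [Finset.mem_coe, SimpleGraph.mem_neighborFinset] at h₁ h₂
    have d₁ : G.dist (f y₁) y₁ = k := by rw [SimpleGraph.dist_comm]; exact hfd _ h₁
    have d₂ : G.dist (f y₁) y₂ = k := by rw [he, SimpleGraph.dist_comm]; exact hfd _ h₂
    have d₃ := hG.dist_adj (f y₁) x y₁ h₁
    have d₄ := hG.connected.dist_triangle (u := x) (v := f y₁) (w := z)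
    have d₅ : G.dist (f y₁) z = 1 := SimpleGraph.dist_eq_one_iff_adj.2 (hf _ h₁).symm
    rw [G.dist_comm (u := x) (v := f y₁)] at d₄
    exact hG.unique (f y₁) x y₁ y₂ k (by omega) (by omega) h₁ h₂ d₁ d₂

lemma degree_eq_of_opposite (hm : 2 ≤ m) {x z : W} (h : G.dist x z = m) :
    G.degree x = G.degree z :=
  le_antisymm (hG.degree_le_of_opposite hm h)
    (hG.degree_le_of_opposite hm (by rw [SimpleGraph.dist_comm]; exact h))

variable (hdeg : ∀ v, 3 ≤ G.degree v)
include hdeg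

omit hG in
lemma exists_third_neighbor (y x z : W) : ∃ u, G.Adj y u ∧ u ≠ x ∧ u ≠ z := by
  classical
  have h1 : ({x, z} : Finset W).card < (G.neighborFinset y).card := by
    rw [G.card_neighborFinset_eq_degree]
    exact lt_of_le_of_lt Finset.card_le_two (hdeg y)
  obtain ⟨u, hu, hn⟩ := Finset.exists_mem_notMem_of_card_lt_card h1
  simp only [Finset.mem_insert, Finset.mem_singleton, not_or] at hn
  exact ⟨u, by simpa using hu, hn.1, hn.2⟩

lemma exists_far {y u : W} (hyu : G.Adj y u) {k : ℕ} (hk : k + 1 < m) :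
    ∃ v, G.dist y v = k + 1 ∧ G.dist u v = k := by
  induction k with
  | zero => exact ⟨u, by simpa using SimpleGraph.dist_eq_one_iff_adj.2 hyu, by simp⟩
  | succ k ih =>
    obtain ⟨v, hv, hu⟩ := ih (by omega)
    obtain ⟨v', hvv', hd⟩ := hG.exists_pred hv
    obtain ⟨x, hvx, hx, -⟩ := exists_third_neighbor hdeg v v' v'
    have h1 : G.dist y x = k + 2 := by
      rcases hG.dist_adj y v x hvx with h | h
      · omega
      · exact absurd (hG.unique y v x v' k (by omega) hv hvx hvv' (by omega) hd) hx
    refine ⟨x, h1, ?_⟩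
    have h2 := hG.dist_adj u v x hvx
    have h3 := hG.connected.dist_triangle (u := y) (v := u) (w := x)
    rw [SimpleGraph.dist_eq_one_iff_adj.2 hyu] at h3
    omega

lemma exists_opposite (hm : 2 ≤ m) (y u : W) (hyu : G.Adj y u) :
    ∃ v, ∀ x, G.Adj y x → x ≠ u → G.dist x v = m := by
  obtain ⟨k, rfl⟩ : ∃ k, m = k + 2 := ⟨m - 2, by omega⟩
  obtain ⟨v, hv, hu⟩ := hG.exists_far hdeg hyu (show k + 1 < k + 2 by omega)
  refine ⟨v, fun x hyx hxu => ?_⟩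
  rw [SimpleGraph.dist_comm] at hv hu ⊢
  rcases hG.dist_adj v y x hyx with h | h
  · omega
  · exact absurd (hG.unique v y x u k (by omega) hv hyx hyu (by omega) hu) hxu

lemma degree_eq_of_common_neighbor (hm : 2 ≤ m) {x y z : W} (hx : G.Adj y x) (hz : G.Adj y z) :
    G.degree x = G.degree z := by
  obtain ⟨u, hyu, hux, huz⟩ := exists_third_neighbor hdeg y x z
  obtain ⟨v, hv⟩ := hG.exists_opposite hdeg hm y u hyu
  rw [hG.degree_eq_of_opposite hm (hv x hx hux.symm),
    hG.degree_eq_of_opposite hm (hv z hz huz.symm)]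

lemma degree_eq (hm : 2 ≤ m) {a b : W} (hab : G.Adj a b) (v : W) :
    G.degree v = if G.dist a v % 2 = 0 then G.degree a else G.degree b := by
  induction hk : G.dist a v using Nat.strong_induction_on generalizing v with
  | _ k ih =>
    match k, hk with
    | 0, hk =>
      rw [hG.connected.dist_eq_zero_iff] at hk
      subst hk
      simp
    | 1, hk =>
      simpa using hG.degree_eq_of_common_neighbor hdeg hm (SimpleGraph.dist_eq_one_iff_adj.1 hk) hab
    | k + 2, hk =>
      obtain ⟨y, hvy, hy⟩ := hG.exists_pred hk
      obtain ⟨z, hyz, hz⟩ := hG.exists_pred hy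
      rw [hG.degree_eq_of_common_neighbor hdeg hm hvy.symm hyz, ih k (by omega) z hz,
        Nat.add_mod_right]

lemma degree_eq_of_odd (hm : 2 ≤ m) (hodd : m % 2 = 1) {a b : W} (hab : G.Adj a b) :
    G.degree a = G.degree b := by
  obtain ⟨u, hbu, hua, -⟩ := exists_third_neighbor hdeg b a a
  obtain ⟨v, hv⟩ := hG.exists_opposite hdeg hm b u hbu
  have h1 := hv a hab.symm hua.symm
  rw [hG.degree_eq_of_opposite hm h1, hG.degree_eq hdeg hm hab v, h1, if_neg (by omega)]

end IsGenPolygon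

namespace IsGenPolygon

variable {W : Type*} [Fintype W] {G : SimpleGraph W} [DecidableRel G.Adj] {m : ℕ}

/-- The vertices at distance less than `j` from `a` whose distance has the parity of `j - 1`. -/
noncomputable def parityBall (G : SimpleGraph W) (a : W) (j : ℕ) : Finset W :=
  Finset.univ.filter fun v => G.dist a v + 1 ≤ j ∧ (G.dist a v + 1) % 2 = j % 2

omit [DecidableRel G.Adj] in
lemma mem_parityBall {a v : W} {j : ℕ} :
    v ∈ parityBall G a j ↔ G.dist a v + 1 ≤ j ∧ (G.dist a v + 1) % 2 = j % 2 := by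
  simp [parityBall]

lemma sum_sum_neighborFinset [DecidableEq W] (B : Finset W) (φ : W → ℝ) :
    ∑ v ∈ B, ∑ u ∈ G.neighborFinset v, φ u
      = ∑ u, ((G.neighborFinset u ∩ B).card : ℝ) * φ u := by
  rw [Finset.sum_comm' (t' := Finset.univ) (s' := fun u => G.neighborFinset u ∩ B)]
  · simp
  · intro x y
    simp [G.adj_comm, and_comm]

variable (hG : IsGenPolygon G m) (hdeg : ∀ v, 3 ≤ G.degree v)
  {a b : W} (hab : G.Adj a b) {φ : W → ℝ} {lam : ℝ}
  (hφ : ∀ v, lam * (G.degree v * φ v) = ∑ u ∈ G.neighborFinset v, φ u)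

/-- The common degree of the vertices whose distance to `a` has the parity of `j`, where `b` is a
neighbor of `a`. -/
def parityDegree (G : SimpleGraph W) [DecidableRel G.Adj] (a b : W) (j : ℕ) : ℕ :=
  if j % 2 = 0 then G.degree a else G.degree b

include hG

omit [DecidableRel G.Adj] in
lemma parityBall_of_le (j : ℕ) (hj : m ≤ j) :
    parityBall G a j = Finset.univ.filter fun v => (G.dist a v + 1) % 2 = j % 2 := by
  ext v
  have := hG.dist_le a v
  simp only [mem_parityBall, Finset.mem_filter, Finset.mem_univ, true_and]
  omega

include hdeg hab hφ

lemma sum_parityBall (hm : 2 ≤ m) (j : ℕ) (hj : j + 1 < m) :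
    lam * (parityDegree G a b j * ∑ v ∈ parityBall G a (j + 1), φ v)
      = ∑ v ∈ parityBall G a (j + 2), φ v
        + (parityDegree G a b (j + 1) - 1) * ∑ v ∈ parityBall G a j, φ v := by
  classical
  have h1 : lam * (parityDegree G a b j * ∑ v ∈ parityBall G a (j + 1), φ v)
      = ∑ v ∈ parityBall G a (j + 1), ∑ u ∈ G.neighborFinset v, φ u := by
    rw [Finset.mul_sum, Finset.mul_sum]
    refine Finset.sum_congr rfl fun v hv => ?_
    rw [mem_parityBall] at hv
    rw [← hφ v, hG.degree_eq hdeg hm hab v, parityDegree, show j % 2 = G.dist a v % 2 by omega]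
  have hcard : ∀ u, ((G.neighborFinset u ∩ parityBall G a (j + 1)).card : ℝ) * φ u =
      (if u ∈ parityBall G a (j + 2) then φ u else 0)
        + (parityDegree G a b (j + 1) - 1) * (if u ∈ parityBall G a j then φ u else 0) := by
    intro u
    by_cases hu : u ∈ parityBall G a j
    · have hu2 : u ∈ parityBall G a (j + 2) := by
        rw [mem_parityBall] at hu ⊢; omega
      have hsub : G.neighborFinset u ∩ parityBall G a (j + 1) = G.neighborFinset u := by
        refine Finset.inter_eq_left.2 fun x hx => ?_
        rw [SimpleGraph.mem_neighborFinset] at hx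
        have := hG.dist_adj a u x hx
        rw [mem_parityBall] at hu ⊢
        omega
      rw [hsub, if_pos hu, if_pos hu2, G.card_neighborFinset_eq_degree,
        hG.degree_eq hdeg hm hab u, parityDegree]
      rw [mem_parityBall] at hu
      rw [show (j + 1) % 2 = G.dist a u % 2 by omega]
      ring
    · rw [if_neg hu]
      by_cases hu2 : u ∈ parityBall G a (j + 2)
      · have hd : G.dist a u = j + 1 := by
          rw [mem_parityBall] at hu hu2; omega
        obtain ⟨y, huy, hy⟩ := hG.exists_pred hd
        have hsing : G.neighborFinset u ∩ parityBall G a (j + 1) = {y} := by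
          ext x
          simp only [Finset.mem_inter, SimpleGraph.mem_neighborFinset, mem_parityBall,
            Finset.mem_singleton]
          constructor
          · rintro ⟨hux, hx, -⟩
            have := hG.dist_adj a u x hux
            exact hG.unique a u x y j hj hd hux huy (by omega) hy
          · rintro rfl
            exact ⟨huy, by omega, by omega⟩
        rw [hsing, if_pos hu2]
        simp
      · have hemp : G.neighborFinset u ∩ parityBall G a (j + 1) = ∅ := by
          ext x
          simp only [Finset.mem_inter, SimpleGraph.mem_neighborFinset, Finset.notMem_empty,
            iff_false, not_and]
          intro hux hx
          have := hG.dist_adj a u x hux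
          rw [mem_parityBall] at hx hu2
          omega
        rw [hemp, if_neg hu2]
        simp
  rw [h1, sum_sum_neighborFinset, Finset.sum_congr rfl fun u _ => hcard u,
    Finset.sum_add_distrib, ← Finset.mul_sum, Finset.sum_ite_mem, Finset.sum_ite_mem,
    Finset.univ_inter, Finset.univ_inter]

omit hdeg hab in
lemma sum_parity (j : ℕ) :
    lam * ∑ v with (G.dist a v + 1) % 2 = j % 2, (G.degree v * φ v)
      = ∑ v with (G.dist a v + 1) % 2 = (j + 1) % 2, (G.degree v * φ v) := by
  classical
  rw [Finset.mul_sum, Finset.sum_congr rfl fun v _ => hφ v, sum_sum_neighborFinset,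
    Finset.sum_filter]
  refine Finset.sum_congr rfl fun u _ => ?_
  by_cases hu : (G.dist a u + 1) % 2 = (j + 1) % 2
  · rw [if_pos hu, Finset.inter_eq_left.2, G.card_neighborFinset_eq_degree]
    intro x hx
    rw [SimpleGraph.mem_neighborFinset] at hx
    have := hG.dist_adj a u x hx
    simp only [Finset.mem_filter, Finset.mem_univ, true_and]
    omega
  · rw [if_neg hu]
    have : G.neighborFinset u ∩ ({v | (G.dist a v + 1) % 2 = j % 2} : Finset W) = ∅ := by
      ext x
      simp only [Finset.mem_inter, SimpleGraph.mem_neighborFinset, Finset.notMem_empty,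
        iff_false, not_and, Finset.mem_filter, Finset.mem_univ, true_and]
      intro hux hx
      have := hG.dist_adj a u x hux
      omega
    rw [this]; simp

lemma sum_parityBall_eq_zero (hm : 2 ≤ m) (hlam : lam ^ 2 ≠ 1) :
    ∑ v ∈ parityBall G a m, φ v = 0 := by
  rw [hG.parityBall_of_le m le_rfl]
  have h1 := hG.sum_parity (a := a) hφ m
  have h2 := hG.sum_parity (a := a) hφ (m + 1)
  rw [show (m + 1 + 1) % 2 = m % 2 by omega, ← h1] at h2
  set T := ∑ v with (G.dist a v + 1) % 2 = m % 2, (G.degree v * φ v) with hT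
  have h3 : (lam ^ 2 - 1) * T = 0 := by linear_combination h2
  have h4 : T = 0 := (mul_eq_zero.1 h3).resolve_left (sub_ne_zero.2 hlam)
  have h5 : T = parityDegree G a b (m + 1) * ∑ v with (G.dist a v + 1) % 2 = m % 2, φ v := by
    rw [hT, Finset.mul_sum]
    refine Finset.sum_congr rfl fun v hv => ?_
    simp only [Finset.mem_filter, Finset.mem_univ, true_and] at hv
    rw [hG.degree_eq hdeg hm hab v, parityDegree, show (m + 1) % 2 = G.dist a v % 2 by omega]
  rw [h5] at h4
  refine (mul_eq_zero.1 h4).resolve_left ?_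
  have h6 := hdeg a
  have h7 := hdeg b
  unfold parityDegree
  split_ifs <;> (norm_cast; omega)

end IsGenPolygon

lemma sqrt_div_add_one_le {q s : ℝ} (hq : 1 ≤ q) (h : q ≤ s) : √s / (s + 1) ≤ √q / (q + 1) := by
  rw [div_le_div_iff₀ (by linarith) (by linarith)]
  have h1 : √q ≤ √s := Real.sqrt_le_sqrt h
  have h2 : 1 ≤ √q := by rw [Real.one_le_sqrt]; exact hq
  have h3 : √q ^ 2 = q := Real.sq_sqrt (by linarith)
  have h4 : √s ^ 2 = s := Real.sq_sqrt (by linarith)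
  have h5 : 1 ≤ √q * √s := by nlinarith
  have h6 : 0 ≤ (√s - √q) * (√q * √s - 1) := mul_nonneg (by linarith) (by linarith)
  nlinarith

lemma add_div_mul_le {q s t : ℝ} (hq : 1 ≤ q) (hs : q ≤ s) (ht : q ≤ t) :
    (s + t) / ((s + 1) * (t + 1)) ≤ 2 * q / (q + 1) ^ 2 := by
  rw [div_le_div_iff₀ (mul_pos (by linarith) (by linarith)) (pow_pos (by linarith) 2)]
  obtain ⟨x, hx, rfl⟩ : ∃ x, 0 ≤ x ∧ s = q + x := ⟨s - q, by linarith, by ring⟩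
  obtain ⟨y, hy, rfl⟩ : ∃ y, 0 ≤ y ∧ t = q + y := ⟨t - q, by linarith, by ring⟩
  have h1 : 0 ≤ (x + y) * (q ^ 2 - 1) := mul_nonneg (by linarith) (by nlinarith)
  have h2 : 0 ≤ q * (x * y) := by positivity
  nlinarith

namespace IsGenPolygon

variable {W : Type*} [Fintype W] {G : SimpleGraph W} [DecidableRel G.Adj] {m : ℕ}

lemma cos_pi_div_nonneg (hm : 2 ≤ m) : 0 ≤ Real.cos (Real.pi / m) := by
  have hmr : (2 : ℝ) ≤ m := by exact_mod_cast hm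
  apply Real.cos_nonneg_of_neg_pi_div_two_le_of_le
  · have : 0 ≤ Real.pi / m := by positivity
    linarith [Real.pi_pos]
  · exact div_le_div_of_nonneg_left Real.pi_pos.le (by norm_num) hmr

/-- An eigenvalue of the simple random walk on a thick generalized polygon different from `1` is at
most the bound known for the regular case. -/
theorem eigenvalue_le (hG : IsGenPolygon G m) (hm : 2 ≤ m) {q : ℝ} (hq : 2 ≤ q)
    (hdeg : ∀ v, q + 1 ≤ G.degree v) {φ : W → ℝ} {lam : ℝ}
    (hφ : ∀ v, lam * (G.degree v * φ v) = ∑ u ∈ G.neighborFinset v, φ u)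
    (hφ0 : φ ≠ 0) (hlam : lam ≠ 1) :
    lam ≤ 2 * √q / (q + 1) * Real.cos (Real.pi / m) := by
  have hcos : 0 ≤ Real.cos (Real.pi / m) := cos_pi_div_nonneg hm
  have hκ : 0 ≤ 2 * √q / (q + 1) := by positivity
  rcases le_or_gt lam 0 with hneg | hpos
  · exact hneg.trans (mul_nonneg hκ hcos)
  have hlam2 : lam ^ 2 ≠ 1 := by
    intro h
    rcases mul_eq_zero.1 (show (lam - 1) * (lam + 1) = 0 by linear_combination h) with h | h
    · exact hlam (sub_eq_zero.1 h)
    · linarith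
  have hdeg3 : ∀ v, 3 ≤ G.degree v := by
    intro v
    have h1 : (3 : ℝ) ≤ G.degree v := by linarith [hdeg v]
    exact_mod_cast h1
  obtain ⟨a, ha⟩ := Function.ne_iff.1 hφ0
  obtain ⟨b, hab, -⟩ := exists_third_neighbor hdeg3 a a a
  set E : ℕ → ℝ := fun j => ∑ v ∈ parityBall G a j, φ v with hE
  have hE0 : E 0 = 0 := by
    simp only [hE]
    rw [show parityBall G a 0 = ∅ by ext v; simp [mem_parityBall]]
    simp
  have hE1 : E 1 = φ a := by
    simp only [hE]
    rw [show parityBall G a 1 = {a} from ?_, Finset.sum_singleton]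
    ext v
    rw [mem_parityBall, Finset.mem_singleton]
    constructor
    · rintro ⟨h, -⟩
      exact (hG.connected.dist_eq_zero_iff.1 (by omega)).symm
    · rintro rfl
      simp
  have hEm : E m = 0 := hG.sum_parityBall_eq_zero hdeg3 hab hφ hm hlam2
  have hrec : ∀ j, j + 1 < m → lam * (parityDegree G a b j * E (j + 1))
      = E (j + 2) + (parityDegree G a b (j + 1) - 1) * E j :=
    fun j hj => hG.sum_parityBall hdeg3 hab hφ hm j hj
  set s : ℝ := G.degree a - 1 with hs
  set t : ℝ := G.degree b - 1 with ht
  have hqs : q ≤ s := by linarith [hdeg a]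
  have hqt : q ≤ t := by linarith [hdeg b]
  have hD0 : ∀ j, j % 2 = 0 → (parityDegree G a b j : ℝ) = s + 1 := by
    intro j hj
    rw [parityDegree, if_pos hj]; ring
  have hD1 : ∀ j, j % 2 = 1 → (parityDegree G a b j : ℝ) = t + 1 := by
    intro j hj
    rw [parityDegree, if_neg (by omega)]; ring
  rcases Nat.mod_two_eq_zero_or_one m with heven | hodd
  · obtain ⟨N, rfl⟩ : ∃ N, m = 2 * N := ⟨m / 2, by omega⟩
    have hE2 : E 2 = lam * ((s + 1) * φ a) := by
      have := hrec 0 (by omega)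
      rw [hD0 0 rfl, hE0, hE1] at this
      linarith
    have hE2ne : E 2 ≠ 0 := by
      rw [hE2]
      exact mul_ne_zero hpos.ne' (mul_ne_zero (by linarith) ha)
    have hN : 2 ≤ N := by
      by_contra hN
      have : N = 1 := by omega
      subst this
      exact hE2ne hEm
    have hNr : (N : ℝ) ≠ 0 := by exact_mod_cast (by omega : N ≠ 0)
    have key := le_two_mul_sqrt_mul_cos (N := N)
      (μ := lam ^ 2 * ((s + 1) * (t + 1)) - (s + t)) (β := s * t)
      (mul_pos (by linarith) (by linarith)) (fun k => E (2 * k)) hE0 hEm ?_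
      ⟨1, by omega, hE2ne⟩
    · set c := Real.cos (Real.pi / N) with hc
      have hc0 : 0 ≤ c := cos_pi_div_nonneg hN
      have hcc : c = 2 * Real.cos (Real.pi / (2 * N : ℕ)) ^ 2 - 1 := by
        rw [hc, ← Real.cos_two_mul]
        congr 1
        push_cast
        field_simp
      have hst : 0 < (s + 1) * (t + 1) := mul_pos (by linarith) (by linarith)
      have h1 : lam ^ 2 ≤ (s + t) / ((s + 1) * (t + 1))
          + 2 * ((√s / (s + 1)) * (√t / (t + 1))) * c := by
        rw [Real.sqrt_mul (by linarith)] at key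
        have e : (s + t) / ((s + 1) * (t + 1)) + 2 * ((√s / (s + 1)) * (√t / (t + 1))) * c
            = (s + t + 2 * (√s * √t) * c) / ((s + 1) * (t + 1)) := by
          have : s + 1 ≠ 0 := by linarith
          have : t + 1 ≠ 0 := by linarith
          field_simp
        rw [e, le_div_iff₀ hst]
        linarith
      have h2 := add_div_mul_le (by linarith) hqs hqt
      have h3 : (√s / (s + 1)) * (√t / (t + 1)) ≤ (√q / (q + 1)) * (√q / (q + 1)) :=
        mul_le_mul (sqrt_div_add_one_le (by linarith) hqs) (sqrt_div_add_one_le (by linarith) hqt)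
          (div_nonneg (Real.sqrt_nonneg _) (by linarith)) (by positivity)
      have h4 := mul_le_mul_of_nonneg_right h3 hc0
      have h5 : (√q / (q + 1)) * (√q / (q + 1)) = q / (q + 1) ^ 2 := by
        rw [div_mul_div_comm, Real.mul_self_sqrt (by linarith), sq]
      refine le_of_sq_le_sq ?_ (mul_nonneg hκ hcos)
      have h6 : (2 * √q / (q + 1) * Real.cos (Real.pi / (2 * N : ℕ))) ^ 2
          = 2 * q / (q + 1) ^ 2 + 2 * (q / (q + 1) ^ 2 * c) := by
        rw [hcc, mul_pow, div_pow, mul_pow, Real.sq_sqrt (by linarith)]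
        ring
      rw [h6, ← h5]
      linarith
    · intro k hk
      have r0 := hrec (2 * k) (by omega)
      have r1 := hrec (2 * k + 1) (by omega)
      have r2 := hrec (2 * k + 2) (by omega)
      rw [hD0 _ (by omega), hD1 _ (by omega)] at r0
      rw [hD1 _ (by omega), hD0 _ (by omega)] at r1
      rw [hD0 _ (by omega), hD1 _ (by omega)] at r2
      have e : (lam ^ 2 * ((s + 1) * (t + 1)) - (s + t)) * E (2 * (k + 1))
          = E (2 * (k + 2)) + s * t * E (2 * k) := by
        rw [show 2 * (k + 1) = 2 * k + 1 + 1 by ring, show 2 * (k + 2) = 2 * k + 2 + 2 by ring]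
        simp only [show 2 * k + 1 + 2 = 2 * k + 2 + 1 by ring] at r1
        rw [show 2 * k + 2 = 2 * k + 1 + 1 by ring] at r0 r2
        linear_combination (lam * (s + 1)) * r1 + r2 + s * r0
      have h1 := congrArg (fun x => |x|) e
      simp only [abs_mul] at h1
      calc _ ≤ |lam ^ 2 * ((s + 1) * (t + 1)) - (s + t)| * |E (2 * (k + 1))| := by
            gcongr; exact le_abs_self _
        _ = |E (2 * (k + 2)) + s * t * E (2 * k)| := h1
        _ ≤ |E (2 * (k + 2))| + |s * t * E (2 * k)| := abs_add_le _ _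
        _ = _ := by
            rw [abs_mul (s * t), abs_of_nonneg (mul_nonneg (by linarith) (by linarith) : 0 ≤ s * t)]
  · have hst : t = s := by rw [hs, ht, hG.degree_eq_of_odd hdeg3 hm hodd hab]
    have hD : ∀ j, (parityDegree G a b j : ℝ) = s + 1 := by
      intro j
      rcases Nat.mod_two_eq_zero_or_one j with h | h
      · exact hD0 j h
      · rw [hD1 j h, hst]
    have key := le_two_mul_sqrt_mul_cos (N := m) (μ := lam * (s + 1)) (β := s) (by linarith) E hE0
      hEm ?_ ⟨1, by omega, by rw [hE1]; exact ha⟩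
    · have h1 := mul_le_mul_of_nonneg_right
        (sqrt_div_add_one_le (q := q) (s := s) (by linarith) hqs) hcos
      have h2 : lam ≤ 2 * (√s / (s + 1) * Real.cos (Real.pi / m)) := by
        have e : 2 * (√s / (s + 1) * Real.cos (Real.pi / m))
          = 2 * √s * Real.cos (Real.pi / m) / (s + 1) := by ring
        rw [e, le_div_iff₀ (by linarith)]
        exact key
      calc lam ≤ _ := h2
        _ ≤ 2 * (√q / (q + 1) * Real.cos (Real.pi / m)) := by linarith
        _ = _ := by ring
    · intro k hk
      have r := hrec k hk
      rw [hD, hD] at r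
      have h1 : |lam * (s + 1) * E (k + 1)| = |E (k + 2) + s * E k| := by
        congr 1; linear_combination r
      rw [abs_mul, abs_of_nonneg (mul_nonneg hpos.le (by linarith) : 0 ≤ lam * (s + 1))] at h1
      rw [h1]
      refine (abs_add_le _ _).trans ?_
      rw [abs_mul, abs_of_nonneg (by linarith : 0 ≤ s)]

end IsGenPolygon

section Walk

variable {W : Type*} [Fintype W] {G : SimpleGraph W} [DecidableRel G.Adj]

lemma mem_eigenspace_walkOperator_iff (hdeg : ∀ v, G.degree v ≠ 0) {φ : W → ℝ} {lam : ℝ} :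
    φ ∈ (walkOperator G).eigenspace lam ↔
      ∀ v, lam * (G.degree v * φ v) = ∑ u ∈ G.neighborFinset v, φ u := by
  rw [Module.End.mem_eigenspace_iff, funext_iff]
  refine forall_congr' fun v => ?_
  have h : (G.degree v : ℝ) ≠ 0 := by exact_mod_cast hdeg v
  change 1 / (G.degree v : ℝ) * _ = lam * φ v ↔ _
  rw [one_div, inv_mul_eq_iff_eq_mul₀ h, eq_comm]
  constructor <;> intro h' <;> rw [← h'] <;> ring

/-- A harmonic function is locally constant. -/
lemma eq_of_mem_eigenspace_one (hdeg : ∀ v, G.degree v ≠ 0) {φ : W → ℝ}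
    (hφ : φ ∈ (walkOperator G).eigenspace 1) {v w : W} (h : G.Adj v w) : φ v = φ w := by
  classical
  rw [mem_eigenspace_walkOperator_iff hdeg] at hφ
  refine ((G.lapMatrix_mulVec_eq_zero_iff_forall_adj).1 ?_) v w h
  funext x
  rw [SimpleGraph.lapMatrix_mulVec_apply, ← hφ x]
  simp

end Walk

namespace IsGenPolygon

variable {W : Type*} [Fintype W] {G : SimpleGraph W} [DecidableRel G.Adj] {m : ℕ}

lemma two_mul_sqrt_div_le_one {q : ℝ} (hq : 0 ≤ q) : 2 * √q / (q + 1) ≤ 1 := by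
  rw [div_le_one (by linarith)]
  nlinarith [Real.sq_sqrt hq, sq_nonneg (√q - 1)]

omit [Fintype W] [DecidableRel G.Adj] in
lemma eq_of_forall_adj (hG : IsGenPolygon G m) {φ : W → ℝ}
    (h : ∀ v w, G.Adj v w → φ v = φ w) (v w : W) : φ v = φ w := by
  obtain ⟨p⟩ := hG.connected.preconnected v w
  induction p with
  | nil => rfl
  | cons hvw _ ih => rw [h _ _ hvw, ih]

omit [Fintype W] [DecidableRel G.Adj] in
lemma neg_one_pow_dist (hG : IsGenPolygon G m) (a : W) {v w : W} (h : G.Adj v w) :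
    (-1 : ℝ) ^ G.dist a w = -(-1) ^ G.dist a v := by
  rcases hG.dist_adj a v w h with h | h
  · rw [h, pow_succ]; ring
  · rw [h, pow_succ]; ring

/-- Changing the sign of an eigenfunction on one side of a bipartite graph changes the sign of the
eigenvalue. -/
lemma eigenfunction_neg (hG : IsGenPolygon G m) (a : W) {φ : W → ℝ} {lam : ℝ}
    (hφ : ∀ v, lam * (G.degree v * φ v) = ∑ u ∈ G.neighborFinset v, φ u) (v : W) :
    -lam * (G.degree v * ((-1) ^ G.dist a v * φ v))
      = ∑ u ∈ G.neighborFinset v, (-1) ^ G.dist a u * φ u := by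
  have h : ∑ u ∈ G.neighborFinset v, (-1 : ℝ) ^ G.dist a u * φ u
      = -(-1) ^ G.dist a v * ∑ u ∈ G.neighborFinset v, φ u := by
    rw [Finset.mul_sum]
    refine Finset.sum_congr rfl fun u hu => ?_
    rw [SimpleGraph.mem_neighborFinset] at hu
    rw [hG.neg_one_pow_dist a hu]
  rw [h, ← hφ v]
  ring

omit [Fintype W] [DecidableRel G.Adj] in
lemma eq_of_common_neighbor_of_neg (hG : IsGenPolygon G m) (a : W) {φ : W → ℝ} {x y z : W}
    (hy : G.Adj x y) (hz : G.Adj x z)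
    (h : (-1) ^ G.dist a y * φ y = (-1) ^ G.dist a z * φ z) : φ y = φ z := by
  rw [hG.neg_one_pow_dist a hy, hG.neg_one_pow_dist a hz] at h
  exact mul_left_cancel₀ (neg_ne_zero.2 (pow_ne_zero _ (by norm_num))) h

/-- The eigenfunctions of the simple random walk separate points. -/
lemma exists_eigenfunction_ne (hdeg : ∀ v, G.degree v ≠ 0) {y z : W} (hyz : y ≠ z) :
    ∃ (φ : W → ℝ) (lam : ℝ),
      (∀ v, lam * (G.degree v * φ v) = ∑ u ∈ G.neighborFinset v, φ u) ∧ φ y ≠ φ z := by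
  classical
  have hs : ∀ v, 0 < √(G.degree v : ℝ) := fun v =>
    Real.sqrt_pos.2 (by exact_mod_cast Nat.pos_of_ne_zero (hdeg v))
  have hss : ∀ v, √(G.degree v : ℝ) * √(G.degree v : ℝ) = G.degree v := fun v =>
    Real.mul_self_sqrt (Nat.cast_nonneg _)
  obtain ⟨N, hN⟩ : ∃ N : Matrix W W ℝ, ∀ v w, N v w =
    (√(G.degree v : ℝ))⁻¹ * (if G.Adj v w then 1 else 0) * (√(G.degree w : ℝ))⁻¹ :=
    ⟨Matrix.of _, fun _ _ => rfl⟩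
  have hH : N.IsHermitian := by
    ext v w
    simp only [Matrix.conjTranspose_apply, hN, star_trivial, G.adj_comm w v]
    ring
  by_contra! hcon
  have hbasis : ∀ k, hH.eigenvectorBasis k y / √(G.degree y : ℝ)
      = hH.eigenvectorBasis k z / √(G.degree z : ℝ) := by
    intro k
    refine hcon (fun v => hH.eigenvectorBasis k v / √(G.degree v : ℝ)) (hH.eigenvalues k) ?_
    intro v
    have h1 := congrFun (hH.mulVec_eigenvectorBasis k) v
    simp only [Matrix.mulVec, dotProduct, hN, Pi.smul_apply, smul_eq_mul] at h1
    have h2 : ∑ u ∈ G.neighborFinset v, hH.eigenvectorBasis k u / √(G.degree u : ℝ)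
        = √(G.degree v : ℝ) * (hH.eigenvalues k * hH.eigenvectorBasis k v) := by
      rw [← h1, Finset.mul_sum, SimpleGraph.neighborFinset_eq_filter, Finset.sum_filter]
      refine Finset.sum_congr rfl fun u _ => ?_
      by_cases h : G.Adj v u
      · rw [if_pos h, if_pos h]
        field_simp [(hs v).ne', (hs u).ne']
      · simp [h]
    rw [h2]
    nth_rw 1 [← hss v]
    field_simp [(hs v).ne']
  let L : EuclideanSpace ℝ W →ₗ[ℝ] ℝ :=
    (√(G.degree y : ℝ))⁻¹ • (EuclideanSpace.proj y : EuclideanSpace ℝ W →L[ℝ] ℝ).toLinearMap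
      - (√(G.degree z : ℝ))⁻¹ • (EuclideanSpace.proj z : EuclideanSpace ℝ W →L[ℝ] ℝ).toLinearMap
  have hL : L = 0 := by
    refine hH.eigenvectorBasis.toBasis.ext fun k => ?_
    have := hbasis k
    simp only [OrthonormalBasis.coe_toBasis, L, LinearMap.sub_apply, LinearMap.smul_apply,
      LinearMap.zero_apply, smul_eq_mul, sub_eq_zero]
    simpa [div_eq_inv_mul] using this
  have h1 := LinearMap.congr_fun hL (EuclideanSpace.single y 1)
  simp only [L, LinearMap.sub_apply, LinearMap.smul_apply, LinearMap.zero_apply, smul_eq_mul] at h1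
  simp [hyz.symm] at h1
  exact hdeg y (by simpa using h1)

variable (hG : IsGenPolygon G m) (hm : 2 ≤ m) {q : ℝ} (hq : 2 ≤ q)
    (hdeg : ∀ v, q + 1 ≤ G.degree v)
include hG hm hq hdeg

lemma le_of_two_le_finrank {μ : ℝ}
    (h2 : 2 ≤ Module.finrank ℝ
      ↥(⨆ ν ∈ Set.Ici μ, (walkOperator G).eigenspace ν : Submodule ℝ (W → ℝ))) :
    μ ≤ 2 * √q / (q + 1) * Real.cos (Real.pi / m) := by
  by_contra! hlt
  have hdeg0 : ∀ v, G.degree v ≠ 0 := fun v h => by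
    have := hdeg v
    rw [h] at this
    push_cast at this
    linarith
  have hle : (⨆ ν ∈ Set.Ici μ, (walkOperator G).eigenspace ν : Submodule ℝ (W → ℝ))
      ≤ Submodule.span ℝ {fun _ => (1 : ℝ)} := by
    refine iSup₂_le fun ν hν φ hφ => ?_
    rw [Submodule.mem_span_singleton]
    by_cases hν1 : ν = 1
    · subst hν1
      obtain ⟨a⟩ := hG.connected.nonempty
      refine ⟨φ a, funext fun v => ?_⟩
      simpa using hG.eq_of_forall_adj (fun v w h => eq_of_mem_eigenspace_one hdeg0 hφ h) a v
    · refine ⟨0, ?_⟩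
      by_contra hne
      rw [zero_smul] at hne
      have := hG.eigenvalue_le hm hq hdeg ((mem_eigenspace_walkOperator_iff hdeg0).1 hφ)
        (Ne.symm hne) hν1
      exact absurd (hlt.trans_le (Set.mem_Ici.1 hν)) (not_lt.2 this)
  obtain ⟨a⟩ := hG.connected.nonempty
  have h3 := (Submodule.finrank_mono hle).trans
    (finrank_span_singleton (fun h => one_ne_zero (congrFun h a))).le
  omega

theorem secondEigenvalue_le :
    secondEigenvalue G ≤ 2 * √q / (q + 1) * Real.cos (Real.pi / m) :=
  Real.sSup_le (fun _ hμ => hG.le_of_two_le_finrank hm hq hdeg hμ.2)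
    (mul_nonneg (by positivity) (cos_pi_div_nonneg hm))

theorem secondEigenvalue_nonneg : 0 ≤ secondEigenvalue G := by
  have hdeg3 : ∀ v, 3 ≤ G.degree v := by
    intro v
    have h1 : (3 : ℝ) ≤ G.degree v := by linarith [hdeg v]
    exact_mod_cast h1
  have hdeg0 : ∀ v, G.degree v ≠ 0 := fun v => by have := hdeg3 v; omega
  obtain ⟨x⟩ := hG.connected.nonempty
  obtain ⟨y, hxy, -, -⟩ := exists_third_neighbor hdeg3 x x x
  obtain ⟨z, hxz, hzy, -⟩ := exists_third_neighbor hdeg3 x y y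
  obtain ⟨φ, lam, hφ, hne⟩ := exists_eigenfunction_ne hdeg0 hzy
  have hlam : lam ≠ 1 := by
    rintro rfl
    exact hne (hG.eq_of_forall_adj (fun v w h =>
      eq_of_mem_eigenspace_one hdeg0 ((mem_eigenspace_walkOperator_iff hdeg0).2 hφ) h) z y)
  have hlam' : lam ≠ -1 := by
    rintro rfl
    have h1 := hG.eigenfunction_neg x hφ
    rw [neg_neg] at h1
    refine hne (hG.eq_of_common_neighbor_of_neg x hxz hxy ?_)
    exact hG.eq_of_forall_adj (φ := fun v => (-1) ^ G.dist x v * φ v) (fun v w h =>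
      eq_of_mem_eigenspace_one hdeg0 ((mem_eigenspace_walkOperator_iff hdeg0).2 h1) h) z y
  have hφ0 : φ ≠ 0 := by
    rintro rfl
    exact hne rfl
  obtain ⟨ψ, hψ, hψ0⟩ : ∃ ψ : W → ℝ,
      (∀ v, |lam| * (G.degree v * ψ v) = ∑ u ∈ G.neighborFinset v, ψ u) ∧ ψ ≠ 0 := by
    rcases abs_choice lam with h | h
    · exact ⟨φ, by rwa [h], hφ0⟩
    · refine ⟨_, by rw [h]; exact hG.eigenfunction_neg x hφ, fun h0 => hφ0 (funext fun v => ?_)⟩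
      have := congrFun h0 v
      simpa using this
  have habs : |lam| ≠ 1 := by
    intro h
    rcases abs_choice lam with h' | h' <;> rw [h'] at h
    · exact hlam h
    · exact hlam' (by linarith)
  have hle1 : |lam| ≤ 1 := by
    refine (hG.eigenvalue_le hm hq hdeg hψ hψ0 habs).trans ?_
    exact mul_le_one₀ (two_mul_sqrt_div_le_one (by linarith)) (cos_pi_div_nonneg hm)
      (Real.cos_le_one _)
  have hψmem := (mem_eigenspace_walkOperator_iff hdeg0).2 hψ
  have hone : (fun _ => (1 : ℝ)) ∈ (walkOperator G).eigenspace 1 := by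
    rw [mem_eigenspace_walkOperator_iff hdeg0]
    intro v
    simp
  have hmem : |lam| ∈ {μ : ℝ | (walkOperator G).HasEigenvalue μ ∧
      2 ≤ Module.finrank ℝ
        ↥(⨆ ν ∈ Set.Ici μ, (walkOperator G).eigenspace ν : Submodule ℝ (W → ℝ))} := by
    refine ⟨Module.End.hasEigenvalue_of_hasEigenvector ⟨hψmem, hψ0⟩, ?_⟩
    set U := (⨆ ν ∈ Set.Ici |lam|, (walkOperator G).eigenspace ν : Submodule ℝ (W → ℝ)) with hU
    have hsub : ∀ ν, |lam| ≤ ν → (walkOperator G).eigenspace ν ≤ U := fun ν hν =>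
      le_iSup₂_of_le ν hν le_rfl
    by_contra! hlt
    obtain ⟨v, hv⟩ := finrank_le_one_iff.1 (show Module.finrank ℝ U ≤ 1 by omega)
    obtain ⟨c, hc⟩ := hv ⟨_, hsub 1 hle1 hone⟩
    obtain ⟨d, hd⟩ := hv ⟨_, hsub _ le_rfl hψmem⟩
    have hc' := congrArg Subtype.val hc
    have hd' := congrArg Subtype.val hd
    simp only [Submodule.coe_smul] at hc' hd'
    have hc0 : c ≠ 0 := by
      rintro rfl
      simpa using congrFun hc' x
    have hψ1 : ψ ∈ (walkOperator G).eigenspace 1 := by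
      have : ψ = (d * c⁻¹) • fun _ => (1 : ℝ) := by
        rw [← hd', ← hc', smul_smul, mul_assoc, inv_mul_cancel₀ hc0, mul_one]
      rw [this]
      exact Submodule.smul_mem _ _ hone
    rw [Module.End.mem_eigenspace_iff] at hψ1 hψmem
    rw [hψ1] at hψmem
    obtain ⟨w, hw⟩ := Function.ne_iff.1 hψ0
    have := congrFun hψmem w
    simp only [Pi.smul_apply, smul_eq_mul] at this
    exact habs (mul_right_cancel₀ hw (by simpa using this.symm))
  refine (abs_nonneg lam).trans (le_csSup
    ⟨2 * √q / (q + 1) * Real.cos (Real.pi / m), fun μ hμ => ?_⟩ hmem)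
  exact hG.le_of_two_le_finrank hm hq hdeg hμ.2

end IsGenPolygon

section PosDef

variable {ι : Type*} [Fintype ι] [DecidableEq ι]

open Matrix

lemma mul_dotProduct_le_of_isLeast {C : Matrix ι ι ℝ} (hC : C.IsHermitian) {μ : ℝ}
    (hμ : IsLeast {x : ℝ | Module.End.HasEigenvalue (Matrix.toLin' C) x} μ) (y : ι → ℝ) :
    μ * (y ⬝ᵥ y) ≤ y ⬝ᵥ C *ᵥ y := by
  have hH : (C - μ • (1 : Matrix ι ι ℝ)).IsHermitian :=
    hC.sub (by simp [Matrix.IsHermitian])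
  have hps : (C - μ • (1 : Matrix ι ι ℝ)).PosSemidef := by
    rw [hH.posSemidef_iff_eigenvalues_nonneg]
    intro k
    have h1 := hH.mulVec_eigenvectorBasis k
    have h2 : Module.End.HasEigenvalue (Matrix.toLin' C) (hH.eigenvalues k + μ) := by
      refine Module.End.hasEigenvalue_of_hasEigenvector
        (x := (hH.eigenvectorBasis k : ι → ℝ)) ⟨?_, ?_⟩
      · rw [Module.End.mem_eigenspace_iff, Matrix.toLin'_apply, add_smul, ← h1,
          Matrix.sub_mulVec, Matrix.smul_mulVec, Matrix.one_mulVec, sub_add_cancel]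
      · intro h
        refine hH.eigenvectorBasis.orthonormal.ne_zero k ?_
        ext v
        exact congrFun h v
    have h3 := hμ.2 h2
    change 0 ≤ _
    linarith
  have h := hps.dotProduct_mulVec_nonneg y
  rw [star_trivial, Matrix.sub_mulVec, Matrix.smul_mulVec, Matrix.one_mulVec, dotProduct_sub,
    dotProduct_smul, smul_eq_mul] at h
  linarith

/-- A symmetric matrix with unit diagonal whose off-diagonal entries are dominated by those of
`κ C` is positive definite, if the smallest eigenvalue of `C` is larger than `1 - 1 / κ`. -/
theorem posDef_of_abs_le {A C : Matrix ι ι ℝ} (hA : A.IsHermitian) (hC : C.IsHermitian) {κ μ : ℝ}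
    (hκ : 0 < κ) (hA1 : ∀ i, A i i = 1) (hC1 : ∀ i, C i i = 1)
    (hAC : ∀ i j, i ≠ j → |A i j| ≤ -(κ * C i j))
    (hμ : IsLeast {x : ℝ | Module.End.HasEigenvalue (Matrix.toLin' C) x} μ)
    (hμκ : 1 - 1 / κ < μ) : A.PosDef := by
  refine Matrix.PosDef.of_dotProduct_mulVec_pos hA fun x hx => ?_
  rw [star_trivial]
  set y : ι → ℝ := fun i => |x i| with hy
  have hyy : 0 < y ⬝ᵥ y := by
    obtain ⟨i, hi⟩ := Function.ne_iff.1 hx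
    refine Finset.sum_pos' (fun j _ => mul_self_nonneg _) ⟨i, Finset.mem_univ i, ?_⟩
    exact mul_pos (abs_pos.2 hi) (abs_pos.2 hi)
  have h1 := mul_dotProduct_le_of_isLeast hC hμ y
  have h2 : κ * (y ⬝ᵥ C *ᵥ y) + (1 - κ) * (y ⬝ᵥ y) ≤ x ⬝ᵥ A *ᵥ x := by
    simp only [dotProduct, mulVec, Finset.mul_sum]
    rw [← Finset.sum_add_distrib]
    refine Finset.sum_le_sum fun i _ => ?_
    have e : (1 - κ) * (y i * y i) = ∑ j, if i = j then (1 - κ) * (y i * y i) else 0 := by simp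
    rw [e, ← Finset.sum_add_distrib]
    refine Finset.sum_le_sum fun j _ => ?_
    by_cases hij : i = j
    · subst hij
      rw [if_pos rfl, hA1, hC1]
      have : y i * y i = x i * x i := abs_mul_abs_self _
      linarith
    · rw [if_neg hij, add_zero]
      have h3 : |x i * (A i j * x j)| ≤ y i * (-(κ * C i j) * y j) := by
        rw [abs_mul, abs_mul]
        have := hAC i j hij
        simp only [hy]
        gcongr
      have h4 := neg_abs_le (x i * (A i j * x j))
      linarith
  have h5 : 0 < κ * μ + (1 - κ) := by
    have := mul_lt_mul_of_pos_left hμκ hκ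
    rw [mul_sub, mul_one_div_cancel hκ.ne'] at this
    linarith
  have h6 := mul_le_mul_of_nonneg_left h1 hκ.le
  have h7 := mul_pos h5 hyy
  linarith

end PosDef

section CoxeterCosine

variable {S : Type*} (M : CoxeterMatrix S)

lemma coxeterCosineMatrix_isHermitian : (coxeterCosineMatrix M).IsHermitian := by
  ext i j
  simp only [Matrix.conjTranspose_apply, coxeterCosineMatrix, star_trivial, M.symmetric j i]

lemma coxeterCosineMatrix_diag (i : S) : coxeterCosineMatrix M i i = 1 := by
  simp [coxeterCosineMatrix]

/-- The off-diagonal entries of the cosine matrix are at most the value for any order which divides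
the entry of the Coxeter matrix. -/
lemma coxeterCosineMatrix_le {i j : S} {m : ℕ} (hm : 2 ≤ m) (hdvd : m ∣ M i j) :
    coxeterCosineMatrix M i j ≤ -Real.cos (Real.pi / m) := by
  unfold coxeterCosineMatrix
  split_ifs with h
  · exact neg_le_neg (Real.cos_le_one _)
  · have hle : m ≤ M i j := Nat.le_of_dvd (Nat.pos_of_ne_zero h) hdvd
    have hm0 : (0 : ℝ) < m := by exact_mod_cast (by omega : 0 < m)
    have hle' : (m : ℝ) ≤ M i j := by exact_mod_cast hle
    refine neg_le_neg (Real.cos_le_cos_of_nonneg_of_le_pi (by positivity) ?_ ?_)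
    · refine div_le_self Real.pi_pos.le ?_
      exact_mod_cast (by omega : 1 ≤ m)
    · exact div_le_div_of_nonneg_left Real.pi_pos.le hm0 hle'

end CoxeterCosine

section Faces

variable {V W P : Type*} {K : PreAbstractSimplicialComplex V} {L : PreAbstractSimplicialComplex W}

lemma isFace_coe {ρ : Finset V} : IsFace K (ρ : Set V) ↔ ρ ∈ K.faces :=
  ⟨fun ⟨_, hσ, h⟩ => Finset.coe_injective h ▸ hσ, fun h => ⟨ρ, h, rfl⟩⟩

lemma mem_vertices_iff {v : V} : v ∈ vertices K ↔ IsFace K {v} := by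
  rw [← Finset.coe_singleton, isFace_coe]; rfl

lemma IsFace.nonempty {A : Set V} (h : IsFace K A) : A.Nonempty := by
  obtain ⟨ρ, hρ, rfl⟩ := h
  exact Finset.coe_nonempty.2 (K.isRelLowerSet_faces hρ).1

lemma IsFace.subset {A B : Set V} (h : IsFace K A) (hB : B ⊆ A) (hne : B.Nonempty) :
    IsFace K B := by
  obtain ⟨ρ, hρ, rfl⟩ := h
  have hfin : B.Finite := ρ.finite_toSet.subset hB
  refine ⟨hfin.toFinset, (K.isRelLowerSet_faces hρ).2 ?_ (by simpa using hne), by simp⟩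
  intro x hx
  exact hB (by simpa using hx)

lemma IsFace.mem_vertices {A : Set V} (h : IsFace K A) {v : V} (hv : v ∈ A) : v ∈ vertices K :=
  mem_vertices_iff.2 (h.subset (Set.singleton_subset_iff.2 hv) (Set.singleton_nonempty v))

lemma IsFace.mono {K' : PreAbstractSimplicialComplex V} (hK : K ≤ K') {A : Set V}
    (h : IsFace K A) : IsFace K' A :=
  let ⟨ρ, hρ, hA⟩ := h
  ⟨ρ, hK hρ, hA⟩

lemma isSimplicialIso_iff {f : V → W} : IsSimplicialIso f K L ↔
    Set.InjOn f (vertices K) ∧ ∀ B, IsFace L B ↔ ∃ A, IsFace K A ∧ f '' A = B := by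
  classical
  refine and_congr_right fun _ => ⟨fun h B => ⟨?_, ?_⟩, fun h ρ => ?_⟩
  · rintro ⟨ρ, hρ, rfl⟩
    obtain ⟨σ, hσ, e⟩ := (h ρ).1 hρ
    exact ⟨σ, isFace_coe.2 hσ, e⟩
  · rintro ⟨_, ⟨σ, hσ, rfl⟩, rfl⟩
    refine ⟨σ.image f, (h _).2 ⟨σ, hσ, by simp⟩, by simp⟩
  · rw [← isFace_coe, h]
    constructor
    · rintro ⟨_, ⟨σ, hσ, rfl⟩, e⟩
      exact ⟨σ, hσ, e⟩
    · rintro ⟨σ, hσ, e⟩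
      exact ⟨σ, isFace_coe.2 hσ, e⟩

namespace IsSimplicialIso

variable {f : V → W} (hf : IsSimplicialIso f K L)
include hf

lemma isFace_image {A : Set V} (h : IsFace K A) : IsFace L (f '' A) :=
  ((isSimplicialIso_iff.1 hf).2 _).2 ⟨A, h, rfl⟩

lemma exists_isFace {B : Set W} (h : IsFace L B) : ∃ A, IsFace K A ∧ f '' A = B :=
  ((isSimplicialIso_iff.1 hf).2 _).1 h

lemma injOn : Set.InjOn f (vertices K) := hf.1

lemma map_mem {v : V} (hv : v ∈ vertices K) : f v ∈ vertices L := by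
  rw [mem_vertices_iff] at hv ⊢
  simpa using hf.isFace_image hv

lemma exists_mem {w : W} (hw : w ∈ vertices L) : ∃ v ∈ vertices K, f v = w := by
  obtain ⟨A, hA, e⟩ := hf.exists_isFace (mem_vertices_iff.1 hw)
  obtain ⟨v, hv⟩ := hA.nonempty
  refine ⟨v, hA.mem_vertices hv, ?_⟩
  have : f v ∈ f '' A := ⟨v, hv, rfl⟩
  rwa [e] at this

lemma isFace_of_image {A : Set V} (hA : A ⊆ vertices K) (h : IsFace L (f '' A)) : IsFace K A := by
  obtain ⟨A', hA', e⟩ := hf.exists_isFace h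
  rw [hf.injOn.image_eq_image_iff (fun _ hv => hA'.mem_vertices hv) hA] at e
  exact e ▸ hA'

lemma comp {Q : PreAbstractSimplicialComplex P} {g : W → P} (hg : IsSimplicialIso g L Q) :
    IsSimplicialIso (g ∘ f) K Q := by
  refine isSimplicialIso_iff.2 ⟨hg.injOn.comp hf.injOn fun v hv => hf.map_mem hv, fun B => ?_⟩
  constructor
  · intro hB
    obtain ⟨A, hA, rfl⟩ := hg.exists_isFace hB
    obtain ⟨A', hA', rfl⟩ := hf.exists_isFace hA
    exact ⟨A', hA', Set.image_comp g f A'⟩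
  · rintro ⟨A, hA, rfl⟩
    rw [Set.image_comp]
    exact hg.isFace_image (hf.isFace_image hA)

lemma isLinkCycle {τ : Set V} {m : ℕ} {p : ℤ → W} (hτ : τ ⊆ vertices K)
    (hp : IsLinkCycle L (f '' τ) m p) :
    ∃ p', IsLinkCycle K τ m p' ∧ ∀ k, p' k ∈ vertices K ∧ f (p' k) = p k := by
  have hv : ∀ k, ∃ v ∈ vertices K, f v = p k := fun k =>
    hf.exists_mem ((hp.face k).mem_vertices (by simp))
  choose p' hp' hfp using hv
  have hinj : ∀ x ∈ vertices K, ∀ k, f x = p k → x = p' k := fun x hx k h =>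
    hf.injOn hx (hp' k) (h.trans (hfp k).symm)
  have hnot : ∀ x ∈ vertices K, x ∉ τ → f x ∉ f '' τ := by
    rintro x hx hxτ ⟨y, hy, e⟩
    exact hxτ (hf.injOn (hτ hy) hx e ▸ hy)
  refine ⟨p', ⟨fun k l => ?_, fun k hk => ?_, fun k => ?_, fun x hx hF => ?_,
    fun x y hx hy hxy hF => ?_⟩, fun k => ⟨hp' k, hfp k⟩⟩
  · rw [← hp.eq_iff, ← hfp, ← hfp, hf.injOn.eq_iff (hp' k) (hp' l)]
  · exact hp.notMem k (hfp k ▸ ⟨_, hk, rfl⟩)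
  · refine hf.isFace_of_image ?_ ?_
    · rintro v ((rfl | rfl) | hv)
      exacts [hp' _, hp' _, hτ hv]
    · rw [Set.image_union, Set.image_pair, hfp, hfp]
      exact hp.face k
  · have hxv := hF.mem_vertices (v := x) (by simp)
    have := hf.isFace_image hF
    rw [Set.image_union, Set.image_singleton] at this
    obtain ⟨k, hk⟩ := hp.exists_eq _ (hnot x hxv hx) this
    exact ⟨k, hinj x hxv k hk⟩
  · have hxv := hF.mem_vertices (v := x) (by simp)
    have hyv := hF.mem_vertices (v := y) (by simp)
    have := hf.isFace_image hF
    rw [Set.image_union, Set.image_pair] at this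
    obtain ⟨k, hk⟩ := hp.exists_edge _ _ (hnot x hxv hx) (hnot y hyv hy)
      (fun e => hxy (hf.injOn hxv hyv e)) this
    exact ⟨k, hk.imp (And.imp (hinj x hxv _) (hinj y hyv _))
      (And.imp (hinj x hxv _) (hinj y hyv _))⟩

end IsSimplicialIso

namespace IsLinkCycle

variable {τ : Set V} {m : ℕ} {p : ℤ → V}

lemma not_two_mul_dvd_one {k l : ℤ} (h : k - l = 1 ∨ k - l = -1) : ¬ (2 * m : ℤ) ∣ k - l := by
  intro hd
  have h2 : (2 : ℤ) ∣ k - l := (Dvd.intro _ rfl : (2 : ℤ) ∣ 2 * m).trans hd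
  omega

lemma reverse (hp : IsLinkCycle K τ m p) : IsLinkCycle K τ m fun k => p (1 - k) := by
  refine ⟨fun k l => ?_, fun k => hp.notMem _, fun k => ?_, fun x hx hF => ?_,
    fun x y hx hy hxy hF => ?_⟩
  · rw [hp.eq_iff, show 1 - k - (1 - l) = -(k - l) by ring, dvd_neg]
  · have := hp.face (1 - (k + 1))
    rw [show 1 - (k + 1) + 1 = 1 - k by ring, Set.pair_comm] at this
    exact this
  · obtain ⟨k, hk⟩ := hp.exists_eq x hx hF
    exact ⟨1 - k, by rw [hk]; congr 1; ring⟩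
  · obtain ⟨k, hk⟩ := hp.exists_edge x y hx hy hxy hF
    refine ⟨-k, ?_⟩
    rw [show 1 - -k = k + 1 by ring, show 1 - (-k + 1) = k by ring]
    exact hk.symm

lemma eq_nat_of_eq (hp : IsLinkCycle K τ m p) (hm : m ≠ 1) {q : ℤ → V}
    (hq : ∀ k l, q k = q l ↔ (2 * m : ℤ) ∣ k - l) (hqn : ∀ k, q k ∉ τ)
    (hqf : ∀ k, IsFace K ({q k, q (k + 1)} ∪ τ)) (h0 : q 0 = p 0) (h1 : q 1 = p 1) (k : ℕ) :
    q k = p k ∧ q (k + 1) = p (k + 1) := by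
  induction k with
  | zero => simpa using ⟨h0, h1⟩
  | succ k ih =>
    push_cast
    refine ⟨ih.2, ?_⟩
    have hne : q (k + 1) ≠ q (k + 1 + 1) := by
      rw [Ne, hq]
      exact not_two_mul_dvd_one (Or.inr (by ring))
    obtain ⟨l, ⟨ha, hb⟩ | ⟨ha, hb⟩⟩ :=
      hp.exists_edge _ _ (hqn _) (hqn _) hne (hqf (k + 1))
    · rw [hb, hp.eq_iff]
      rw [ih.2, hp.eq_iff] at ha
      rw [show l + 1 - (k + 1 + 1 : ℤ) = -((k + 1 : ℤ) - l) by ring, dvd_neg]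
      exact ha
    · exfalso
      rw [ih.2, hp.eq_iff] at ha
      have e : q (k + 1 + 1) = q k := by
        rw [hb, ih.1, hp.eq_iff]
        rw [show l - (k : ℤ) = -((k + 1 : ℤ) - (l + 1)) by ring, dvd_neg]
        exact ha
      rw [hq, show (k : ℤ) + 1 + 1 - k = 2 * 1 by ring,
        mul_dvd_mul_iff_left (by norm_num)] at e
      exact hm (by exact_mod_cast Int.eq_one_of_dvd_one (by positivity) e)

/-- A parametrization of the cycle is determined by two consecutive values. -/
lemma eq_of_eq (hp : IsLinkCycle K τ m p) (hm : m ≠ 1) {q : ℤ → V}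
    (hq : ∀ k l, q k = q l ↔ (2 * m : ℤ) ∣ k - l) (hqn : ∀ k, q k ∉ τ)
    (hqf : ∀ k, IsFace K ({q k, q (k + 1)} ∪ τ)) (h0 : q 0 = p 0) (h1 : q 1 = p 1) (k : ℤ) :
    q k = p k := by
  obtain ⟨l, rfl | rfl⟩ := Int.eq_nat_or_neg k
  · exact (hp.eq_nat_of_eq hm hq hqn hqf h0 h1 l).1
  · have := (hp.reverse.eq_nat_of_eq hm (q := fun k => q (1 - k)) (fun k l => ?_)
      (fun k => hqn _) (fun k => ?_) (by simpa using h1) (by simpa using h0) l).2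
    · simpa using this
    · rw [hq, show 1 - k - (1 - l) = -(k - l) by ring, dvd_neg]
    · have := hqf (1 - (k + 1))
      rw [show 1 - (k + 1) + 1 = 1 - k by ring, Set.pair_comm] at this
      exact this

end IsLinkCycle

end Faces

section Fold

variable {W : Type*} {G : SimpleGraph W} {m : ℕ}

lemma exists_int_of_walk {ρ : W → ℤ}
    (hρ : ∀ x y, G.Adj x y → (2 * m : ℤ) ∣ ρ y - ρ x - 1 ∨ (2 * m : ℤ) ∣ ρ y - ρ x + 1)
    {x y : W} (p : G.Walk x y) : ∃ z : ℤ, |z| ≤ p.length ∧ (2 * m : ℤ) ∣ ρ y - ρ x - z := by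
  induction p with
  | nil => exact ⟨0, by simp, by simp⟩
  | @cons u v w h p ih =>
    obtain ⟨z, hz, hd⟩ := ih
    rw [abs_le] at hz
    rw [SimpleGraph.Walk.length_cons]
    push_cast
    rcases hρ u v h with h | h
    · refine ⟨z + 1, abs_le.2 (by omega), ?_⟩
      have := dvd_add hd h
      rwa [show ρ w - ρ v - z + (ρ v - ρ u - 1) = ρ w - ρ u - (z + 1) by ring] at this
    · refine ⟨z - 1, abs_le.2 (by omega), ?_⟩
      have := dvd_add hd h
      rwa [show ρ w - ρ v - z + (ρ v - ρ u + 1) = ρ w - ρ u - (z - 1) by ring] at this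

/-- `ρ` folds the graph `G` onto a cycle of length `2 * m`, preserving the distance to `a` and
separating the neighbor `b` of `a` from the other ones. -/
structure IsFolding (G : SimpleGraph W) (m : ℕ) (a b : W) (ρ : W → ℤ) : Prop where
  map_base : ρ a = 0
  map_neighbor : ρ b = 1
  map_other : ∀ b', G.Adj a b' → b' ≠ b → (2 * m : ℤ) ∣ ρ b' + 1
  adj : ∀ x y, G.Adj x y → (2 * m : ℤ) ∣ ρ y - ρ x - 1 ∨ (2 * m : ℤ) ∣ ρ y - ρ x + 1
  abs_le : ∀ x, |ρ x| ≤ m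
  exists_walk : ∀ x, ∃ p : G.Walk a x, (p.length : ℤ) = |ρ x|

lemma IsFolding.dist_eq {a b : W} {ρ : W → ℤ} (h : IsFolding G m a b ρ) (x : W) :
    (G.dist a x : ℤ) = |ρ x| := by
  obtain ⟨p, hp⟩ := h.exists_walk x
  refine le_antisymm (by rw [← hp]; exact_mod_cast SimpleGraph.dist_le p) ?_
  obtain ⟨p', hp'⟩ := (SimpleGraph.Walk.reachable p).exists_walk_length_eq_dist
  obtain ⟨z, hz, hd⟩ := exists_int_of_walk h.adj p'
  rw [h.map_base, sub_zero, hp'] at *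
  have hx := h.abs_le x
  by_contra! hlt
  have h0 := Int.eq_zero_of_abs_lt_dvd hd (by
    calc |ρ x - z| ≤ |ρ x| + |z| := abs_sub _ _
      _ < 2 * m := by omega)
  have : ρ x = z := by omega
  rw [this] at hlt
  omega

theorem isGenPolygon_of_isFolding [Nonempty W] (hm : 2 ≤ m) (hnbr : ∀ a, ∃ b, G.Adj a b)
    (h : ∀ a b, G.Adj a b → ∃ ρ, IsFolding G m a b ρ) : IsGenPolygon G m := by
  have hconn : G.Connected := by
    refine (SimpleGraph.connected_iff _).2 ⟨fun a x => ?_, inferInstance⟩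
    obtain ⟨b, hab⟩ := hnbr a
    obtain ⟨ρ, hρ⟩ := h a b hab
    obtain ⟨p, -⟩ := hρ.exists_walk x
    exact p.reachable
  refine ⟨hconn, fun a x => ?_, fun a x y hxy => ?_, fun a x y y' k hk hax hxy hxy' hy hy' => ?_⟩
  · obtain ⟨b, hab⟩ := hnbr a
    obtain ⟨ρ, hρ⟩ := h a b hab
    have := hρ.dist_eq x
    have := hρ.abs_le x
    omega
  · obtain ⟨b, hab⟩ := hnbr a
    obtain ⟨ρ, hρ⟩ := h a b hab
    have h1 := hρ.dist_eq x
    have h2 := hρ.dist_eq y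
    have h3 := hρ.abs_le x
    have h4 := hρ.abs_le y
    rw [_root_.abs_le] at h3 h4
    have hcases : ∀ c : ℤ, (ρ y - ρ x - 1 = 2 * m * c ∨ ρ y - ρ x + 1 = 2 * m * c) →
        c = -1 ∨ c = 0 ∨ c = 1 := by
      intro c hc
      have hm' : (2 : ℤ) ≤ m := by exact_mod_cast hm
      have h5 : c < 2 := by
        by_contra! h5
        have := mul_le_mul_of_nonneg_left h5 (by omega : (0 : ℤ) ≤ 2 * m)
        omega
      have h6 : -2 < c := by
        by_contra! h6
        have := mul_le_mul_of_nonneg_left h6 (by omega : (0 : ℤ) ≤ 2 * m)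
        omega
      omega
    rcases hρ.adj x y hxy with ⟨c, hc⟩ | ⟨c, hc⟩
    · rcases hcases c (Or.inl hc) with rfl | rfl | rfl <;>
        rcases abs_cases (ρ x) with hx | hx <;> rcases abs_cases (ρ y) with hy | hy <;> omega
    · rcases hcases c (Or.inr hc) with rfl | rfl | rfl <;>
        rcases abs_cases (ρ x) with hx | hx <;> rcases abs_cases (ρ y) with hy | hy <;> omega
  · by_contra hne
    obtain ⟨ρ, hρ⟩ := h x y hxy
    obtain ⟨p, hp⟩ := hconn.exists_walk_length_eq_dist y a
    obtain ⟨p', hp'⟩ := hconn.exists_walk_length_eq_dist y' a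
    rw [SimpleGraph.dist_comm, hy] at hp
    rw [SimpleGraph.dist_comm, hy'] at hp'
    obtain ⟨z, hz, hd⟩ := exists_int_of_walk hρ.adj p
    obtain ⟨z', hz', hd'⟩ := exists_int_of_walk hρ.adj p'
    have ha := hρ.dist_eq a
    rw [SimpleGraph.dist_comm, hax] at ha
    have hy'1 := hρ.map_other y' hxy' (Ne.symm hne)
    have hd'' := dvd_add hd' hy'1
    rw [show ρ a - ρ y' - z' + (ρ y' + 1) = ρ a + 1 - z' by ring] at hd''
    rw [hρ.map_neighbor] at hd
    rw [hp, _root_.abs_le] at hz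
    rw [hp', _root_.abs_le] at hz'
    push_cast at ha
    rcases abs_choice (ρ a) with h1 | h1
    · have := Int.eq_zero_of_abs_lt_dvd hd'' (abs_lt.2 (by omega))
      omega
    · have := Int.eq_zero_of_abs_lt_dvd hd (abs_lt.2 (by omega))
      omega

end Fold

section Typing

variable {V : Type*} {n : ℕ} {M : CoxeterMatrix (Fin (n + 1))}

lemma cosetVertex_injective (w : M.Group) : Function.Injective (cosetVertex M w) :=
  fun _ _ h => congrArg Sigma.fst h

lemma isFace_range_cosetVertex (w : M.Group) :
    IsFace (coxeterComplex M) (Set.range (cosetVertex M w)) :=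
  isFace_coxeterComplex.2 ⟨Set.range_nonempty _, w, by rintro _ ⟨s, rfl⟩; rfl⟩

/-- An isomorphism onto the Coxeter complex which respects types on one chamber respects all
types. -/
lemma type_eq_of_isSimplicialIso {K : PreAbstractSimplicialComplex V} {f : V → CoxeterVertex M}
    (hf : IsSimplicialIso f K (coxeterComplex M)) {t : V → Fin (n + 1)}
    (hinj : ∀ A, IsFace K A → Set.InjOn t A) {w₀ : M.Group}
    (h : ∀ v ∈ vertices K, ∀ s, f v = cosetVertex M w₀ s → t v = s) {v : V}
    (hv : v ∈ vertices K) : (f v).1 = t v := by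
  have key : ∀ u : M.Group, ∀ v ∈ vertices K, ∀ s, f v = cosetVertex M (w₀ * u) s → t v = s := by
    intro u
    induction u using M.toCoxeterSystem.simple_induction_right with
    | one => simpa using h
    | mul_simple_right u k ih =>
      rw [CoxeterMatrix.toCoxeterSystem_simple, ← mul_assoc]
      have hs : ∀ v ∈ vertices K, ∀ s ≠ k,
          f v = cosetVertex M (w₀ * u * M.simple k) s → t v = s := by
        intro v hv s hsk e
        rw [cosetVertex_mul (simple_mem_maxParabolic hsk.symm)] at e
        exact ih v hv s e
      intro v hv s e
      by_cases hsk : s = k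
      · subst hsk
        by_contra hne
        obtain ⟨C, hC, hCf⟩ := hf.exists_isFace
          (isFace_range_cosetVertex (w₀ * u * M.simple s))
        have hmem : ∀ r, ∃ c ∈ C, f c = cosetVertex M (w₀ * u * M.simple s) r := by
          intro r
          have : cosetVertex M (w₀ * u * M.simple s) r ∈ f '' C := hCf ▸ ⟨r, rfl⟩
          exact this
        obtain ⟨c, hc, hcf⟩ := hmem s
        obtain rfl : c = v := hf.injOn (hC.mem_vertices hc) hv (hcf.trans e.symm)
        obtain ⟨c', hc', hcf'⟩ := hmem (t c)
        have h1 := hs c' (hC.mem_vertices hc') _ hne hcf'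
        obtain rfl := hinj C hC hc' hc h1
        exact hne (cosetVertex_injective _ (hcf'.symm.trans e))
      · exact hs v hv s hsk e
  obtain ⟨w, hw⟩ := exists_cosetVertex (f v)
  refine (key (w₀⁻¹ * w) v hv _ ?_).symm
  rw [mul_inv_cancel_left]
  exact hw

end Typing

namespace Building

variable {V : Type*} {n : ℕ} (X : Building V n) {t : V → Fin (n + 1)}

/-- Every simplex of an apartment lies in a chamber of this apartment, on which the type function is
bijective. -/
lemma exists_chamber (ht : IsTypeFunction X.complex t) {K : PreAbstractSimplicialComplex V}
    (hK : K ∈ X.apartments) {A : Set V} (hA : IsFace K A) :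
    ∃ C, IsFace K C ∧ A ⊆ C ∧ Set.BijOn t C Set.univ ∧ C.ncard = n + 1 := by
  obtain ⟨M, f, hf⟩ := X.apartment_coxeter K hK
  obtain ⟨-, w, hw⟩ := isFace_coxeterComplex.1 (hf.isFace_image hA)
  obtain ⟨C, hC, hCf⟩ := hf.exists_isFace (isFace_range_cosetVertex w)
  have hcard : C.ncard = n + 1 := by
    rw [← (hf.injOn.mono fun _ hv => hC.mem_vertices hv).ncard_image, hCf,
      ← Set.image_univ, Set.ncard_image_of_injective _ (cosetVertex_injective w), Set.ncard_univ,
      Nat.card_fin]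
  refine ⟨C, hC, fun v hv => ?_, ?_, hcard⟩
  · have : f v ∈ f '' C := by
      rw [hCf]
      exact ⟨_, (hw (f v) ⟨v, hv, rfl⟩).symm⟩
    obtain ⟨c, hc, e⟩ := this
    exact hf.injOn (hC.mem_vertices hc) (hA.mem_vertices hv) e ▸ hc
  · obtain ⟨σ, hσ, rfl⟩ := hC
    rw [Set.ncard_coe_finset] at hcard
    have := ht σ (X.apartment_le K hK hσ) hcard
    refine ⟨Set.mapsTo_univ _ _, fun x hx y hy e => ?_, fun i _ => ?_⟩
    · exact (this (t y)).unique ⟨hx, e⟩ ⟨hy, rfl⟩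
    · obtain ⟨v, hv, -⟩ := this i
      exact ⟨v, hv⟩

lemma exists_apartment_of_isFace {A B : Set V} (hA : IsFace X.complex A)
    (hB : IsFace X.complex B) : ∃ K ∈ X.apartments, IsFace K A ∧ IsFace K B := by
  obtain ⟨σ, hσ, rfl⟩ := hA
  obtain ⟨τ, hτ, rfl⟩ := hB
  obtain ⟨K, hK, h1, h2⟩ := X.exists_apartment σ hσ τ hτ
  exact ⟨K, hK, isFace_coe.2 h1, isFace_coe.2 h2⟩

lemma exists_iso_of_isFace {K L : PreAbstractSimplicialComplex V} (hK : K ∈ X.apartments)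
    (hL : L ∈ X.apartments) {A B : Set V} (hA : IsFace K A) (hB : IsFace K B) (hA' : IsFace L A)
    (hB' : IsFace L B) :
    ∃ f : V → V, IsSimplicialIso f K L ∧ (∀ v ∈ A, f v = v) ∧ (∀ v ∈ B, f v = v) := by
  obtain ⟨σ, hσ, rfl⟩ := hA
  obtain ⟨τ, hτ, rfl⟩ := hB
  exact X.exists_iso K hK L hL σ τ hσ hτ (isFace_coe.1 hA') (isFace_coe.1 hB')

lemma injOn_type (ht : IsTypeFunction X.complex t) {A : Set V} (hA : IsFace X.complex A) :
    Set.InjOn t A := by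
  obtain ⟨K, hK, h, -⟩ := X.exists_apartment_of_isFace hA hA
  obtain ⟨C, -, hAC, hC, -⟩ := X.exists_chamber ht hK h
  exact hC.injOn.mono hAC

variable {M : CoxeterMatrix (Fin (n + 1))}

lemma exists_typed_iso_of_common_chamber (ht : IsTypeFunction X.complex t)
    {K L : PreAbstractSimplicialComplex V} (hK : K ∈ X.apartments) (hL : L ∈ X.apartments)
    {C : Set V} (hCK : IsFace K C) (hCL : IsFace L C) (hC : Set.BijOn t C Set.univ)
    (h : ∃ f : V → CoxeterVertex M, IsSimplicialIso f L (coxeterComplex M) ∧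
      ∀ v ∈ vertices L, (f v).1 = t v) :
    ∃ f : V → CoxeterVertex M, IsSimplicialIso f K (coxeterComplex M) ∧
      ∀ v ∈ vertices K, (f v).1 = t v := by
  obtain ⟨f, hf, hft⟩ := h
  obtain ⟨g, hg, hgC, -⟩ := X.exists_iso_of_isFace hK hL hCK hCK hCL hCL
  obtain ⟨-, w, hw⟩ := isFace_coxeterComplex.1 (hf.isFace_image hCL)
  have hgf := hg.comp hf
  refine ⟨f ∘ g, hgf, fun v hv => type_eq_of_isSimplicialIso hgf
    (fun A hA => X.injOn_type ht (hA.mono (X.apartment_le K hK))) (w₀ := w) ?_ hv⟩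
  intro v hv s e
  obtain ⟨c, hc, rfl⟩ := hC.surjOn (Set.mem_univ s)
  have h1 := hw (f c) ⟨c, hc, rfl⟩
  rw [hft c (hCL.mem_vertices hc)] at h1
  have h2 : (f ∘ g) c = (f ∘ g) v := by
    rw [e, ← h1, Function.comp_apply, hgC c hc]
  rw [hgf.injOn (hCK.mem_vertices hc) hv h2]

lemma exists_isFace_apartment {K : PreAbstractSimplicialComplex V} (hK : K ∈ X.apartments) :
    ∃ A, IsFace K A := by
  obtain ⟨M, f, hf⟩ := X.apartment_coxeter K hK
  obtain ⟨A, hA, -⟩ := hf.exists_isFace (isFace_range_cosetVertex 1)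
  exact ⟨A, hA⟩

/-- Every apartment is isomorphic to the Coxeter complex by an isomorphism respecting types. -/
theorem exists_typed_iso (ht : IsTypeFunction X.complex t) (hM : X.HasCoxeterMatrix t M)
    {K : PreAbstractSimplicialComplex V} (hK : K ∈ X.apartments) :
    ∃ f : V → CoxeterVertex M, IsSimplicialIso f K (coxeterComplex M) ∧
      ∀ v ∈ vertices K, (f v).1 = t v := by
  obtain ⟨K₀, hK₀, h₀⟩ := hM
  obtain ⟨A₀, hA₀⟩ := X.exists_isFace_apartment hK₀
  obtain ⟨A, hA⟩ := X.exists_isFace_apartment hK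
  obtain ⟨C₀, hC₀, -, hC₀t, -⟩ := X.exists_chamber ht hK₀ hA₀
  obtain ⟨C, hC, -, hCt, -⟩ := X.exists_chamber ht hK hA
  obtain ⟨L, hL, hLC₀, hLC⟩ := X.exists_apartment_of_isFace (hC₀.mono (X.apartment_le K₀ hK₀))
    (hC.mono (X.apartment_le K hK))
  exact X.exists_typed_iso_of_common_chamber ht hK hL hC hLC hCt
    (X.exists_typed_iso_of_common_chamber ht hL hK₀ hLC₀ hC₀ hC₀t h₀)

/-- In a building with at least two chambers on every panel, the simple reflections are
independent. -/
theorem simpleIndep (hn : 0 < n) (ht : IsTypeFunction X.complex t) (hM : X.HasCoxeterMatrix t M)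
    {q : ℝ} (hq : 1 < q) (hthick : X.ThicknessAtLeast q) : SimpleIndep M := by
  classical
  intro k hk
  have htop : maxParabolic M k = ⊤ := by
    rw [eq_top_iff, ← M.toCoxeterSystem.subgroup_closure_range_simple, Subgroup.closure_le]
    rintro _ ⟨i, rfl⟩
    by_cases hik : i = k
    · subst hik; exact hk
    · exact simple_mem_maxParabolic hik
  have huniq : ∀ v ∈ vertices X.complex, ∀ v' ∈ vertices X.complex, t v = k → t v' = k →
      v = v' := by
    intro v hv v' hv' htv htv'
    obtain ⟨K, hK, h1, h2⟩ := X.exists_apartment_of_isFace (mem_vertices_iff.1 hv)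
      (mem_vertices_iff.1 hv')
    obtain ⟨f, hf, hft⟩ := X.exists_typed_iso ht hM hK
    have h1' := h1.mem_vertices rfl
    have h2' := h2.mem_vertices rfl
    refine hf.injOn h1' h2' ?_
    obtain ⟨w, hw⟩ := exists_cosetVertex (f v)
    obtain ⟨w', hw'⟩ := exists_cosetVertex (f v')
    rw [hft v h1', htv] at hw
    rw [hft v' h2', htv'] at hw'
    rw [hw, hw', cosetVertex_eq_iff, htop]
    trivial
  obtain ⟨K, hK⟩ := X.apartments_nonempty
  obtain ⟨A, hA⟩ := X.exists_isFace_apartment hK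
  obtain ⟨C, hC, -, hCt, hcard⟩ := X.exists_chamber ht hK hA
  obtain ⟨σ, hσ, rfl⟩ := hC
  rw [Set.ncard_coe_finset] at hcard
  have hσX := X.apartment_le K hK hσ
  obtain ⟨v, hv, hvk⟩ := hCt.surjOn (Set.mem_univ k)
  have hcard' : (σ.erase v).card = n := by rw [Finset.card_erase_of_mem hv, hcard]; rfl
  have hpanel : σ.erase v ∈ X.complex.faces :=
    (X.complex.isRelLowerSet_faces hσX).2 (Finset.erase_subset _ _)
      (Finset.card_pos.1 (by omega))
  obtain ⟨T, hT, hqT⟩ := hthick _ hpanel hcard'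
  have hTσ : T ⊆ {σ} := by
    intro c hc
    obtain ⟨hcX, hcn, hsub⟩ := hT c hc
    obtain ⟨u, ⟨huc, huk⟩, -⟩ := ht c hcX hcn k
    have huv : u = v := huniq u ((isFace_coe.2 hcX).mem_vertices huc) v
      ((isFace_coe.2 hσX).mem_vertices hv) huk hvk
    subst huv
    rw [Finset.mem_singleton]
    refine (Finset.eq_of_subset_of_card_le ?_ (by omega)).symm
    intro x hx
    by_cases hxu : x = u
    · rwa [hxu]
    · exact hsub (Finset.mem_erase.2 ⟨hxu, hx⟩)
  have h1 : (T.card : ℝ) ≤ 1 := by exact_mod_cast Finset.card_le_card hTσ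
  linarith

/-- The link of a simplex of cotype `{i, j}` in an apartment is a cycle. -/
theorem exists_isLinkCycle (ht : IsTypeFunction X.complex t) (hM : X.HasCoxeterMatrix t M)
    (hind : SimpleIndep M) {K : PreAbstractSimplicialComplex V} (hK : K ∈ X.apartments)
    {τ : Set V} {a b : V} (hab : t a ≠ t b) (hτ : t '' τ = {t a, t b}ᶜ)
    (hF : IsFace K ({a, b} ∪ τ)) :
    ∃ p, IsLinkCycle K τ (orderOf (M.simple (t a) * M.simple (t b))) p ∧ p 0 = a ∧ p 1 = b := by
  obtain ⟨f, hf, hft⟩ := X.exists_typed_iso ht hM hK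
  obtain ⟨-, w, hw⟩ := isFace_coxeterComplex.1 (hf.isFace_image hF)
  have hfw : ∀ v ∈ ({a, b} ∪ τ : Set V), f v = cosetVertex M w (t v) := by
    intro v hv
    rw [← hft v (hF.mem_vertices hv)]
    exact hw _ ⟨v, hv, rfl⟩
  have hfτ : f '' τ = cosetVertex M w '' {t a, t b}ᶜ := by
    rw [← hτ, Set.image_image]
    exact Set.image_congr fun v hv => hfw v (Or.inr hv)
  have hcyc := isLinkCycle_linkSeq hind w hab
  rw [← hfτ] at hcyc
  obtain ⟨p, hp, hpv⟩ := hf.isLinkCycle (fun v hv => hF.mem_vertices (Or.inr hv)) hcyc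
  refine ⟨p, hp, hf.injOn (hpv 0).1 (hF.mem_vertices (by simp)) ?_,
    hf.injOn (hpv 1).1 (hF.mem_vertices (by simp)) ?_⟩
  · rw [(hpv 0).2, hfw a (by simp)]
    simpa using linkSeq_even w (t a) (t b) 0
  · rw [(hpv 1).2, hfw b (by simp)]
    simpa using linkSeq_odd w (t a) (t b) 0

end Building

section Link

variable {V : Type*} [DecidableEq V] {K : PreAbstractSimplicialComplex V} {τ : Finset V}

lemma mem_vertices_link {x : V} :
    x ∈ vertices (link K τ) ↔ x ∉ τ ∧ IsFace K ({x} ∪ (τ : Set V)) := by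
  rw [← Finset.coe_singleton, ← Finset.coe_union, isFace_coe]
  change (({x} : Finset V).Nonempty ∧ Disjoint {x} τ ∧ {x} ∪ τ ∈ K.faces) ↔ _
  simp

lemma skeletonGraph_link_adj {x y : vertices (link K τ)} :
    (skeletonGraph (link K τ)).Adj x y ↔
      x ≠ y ∧ IsFace K ({x.1, y.1} ∪ (τ : Set V)) := by
  have hx := (mem_vertices_link.1 x.2).1
  have hy := (mem_vertices_link.1 y.2).1
  rw [← Finset.coe_pair, ← Finset.coe_union, isFace_coe]
  change (x ≠ y ∧ (({x.1, y.1} : Finset V).Nonempty ∧ Disjoint {x.1, y.1} τ ∧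
    {x.1, y.1} ∪ τ ∈ K.faces)) ↔ _
  simp [hx, hy]

end Link

namespace IsLinkCycle

variable {V : Type*} [DecidableEq V] {K X : PreAbstractSimplicialComplex V} {τ : Finset V} {m : ℕ}
  {p : ℤ → V}

lemma mem_vertices_link (hp : IsLinkCycle K τ m p) (hK : K ≤ X) (k : ℤ) :
    p k ∈ vertices (link X τ) :=
  BuildingCosine.mem_vertices_link.2 ⟨hp.notMem k, ((hp.face k).subset
    (Set.union_subset_union_left _ (by simp)) (by simp)).mono hK⟩

lemma adj (hp : IsLinkCycle K τ m p) (hK : K ≤ X) (k : ℤ) :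
    (skeletonGraph (link X τ)).Adj ⟨p k, hp.mem_vertices_link hK k⟩
      ⟨p (k + 1), hp.mem_vertices_link hK (k + 1)⟩ := by
  refine skeletonGraph_link_adj.2 ⟨fun h => ?_, (hp.face k).mono hK⟩
  have h1 : p k = p (k + 1) := congrArg Subtype.val h
  rw [hp.eq_iff] at h1
  exact not_two_mul_dvd_one (Or.inr (by ring)) h1

lemma exists_walk (hp : IsLinkCycle K τ m p) (hK : K ≤ X) (k : ℤ) :
    ∃ q : (skeletonGraph (link X τ)).Walk ⟨p 0, hp.mem_vertices_link hK 0⟩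
      ⟨p k, hp.mem_vertices_link hK k⟩, (q.length : ℤ) = |k| := by
  induction k using Int.induction_on with
  | zero => exact ⟨.nil, by simp⟩
  | succ k ih =>
    obtain ⟨q, hq⟩ := ih
    refine ⟨q.concat (hp.adj hK k), ?_⟩
    rw [SimpleGraph.Walk.length_concat]
    push_cast
    rw [hq]
    rw [abs_of_nonneg (by omega), abs_of_nonneg (by omega)]
  | pred k ih =>
    obtain ⟨q, hq⟩ := ih
    have h := hp.adj hK (-(k : ℤ) - 1)
    simp only [sub_add_cancel] at h
    refine ⟨q.concat h.symm, ?_⟩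
    rw [SimpleGraph.Walk.length_concat]
    push_cast
    rw [hq]
    rw [abs_of_nonpos (by omega), abs_of_nonpos (by omega)]
    ring

omit [DecidableEq V] in
lemma exists_abs_le (hp : IsLinkCycle K τ m p) (hm : 0 < m) (k : ℤ) :
    ∃ l, p l = p k ∧ |l| ≤ m := by
  have h2m : (0 : ℤ) < 2 * m := by omega
  have h1 := Int.emod_nonneg (k + m) h2m.ne'
  have h2 := Int.emod_lt_of_pos (k + m) h2m
  refine ⟨(k + m) % (2 * m) - m, ?_, abs_le.2 ⟨by omega, by omega⟩⟩
  rw [hp.eq_iff]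
  refine ⟨-((k + m) / (2 * m)), ?_⟩
  have := Int.emod_add_mul_ediv (k + m) (2 * m)
  linear_combination this

end IsLinkCycle

namespace Building

variable {V : Type*} {n : ℕ} (X : Building V n) {τ : Finset V} {m : ℕ}

/-- The position of a vertex on a cycle through a given edge of the link does not depend on the
apartment containing both. -/
lemma dvd_sub_of_isLinkCycle (hm : m ≠ 1) {K L : PreAbstractSimplicialComplex V}
    (hK : K ∈ X.apartments) (hL : L ∈ X.apartments) {p p' : ℤ → V} (hp : IsLinkCycle K τ m p)
    (hp' : IsLinkCycle L τ m p') (h0 : p 0 = p' 0) (h1 : p 1 = p' 1) {k l : ℤ}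
    (hkl : p k = p' l) : (2 * m : ℤ) ∣ k - l := by
  have hF := hp.face 0
  have hF' := hp'.face 0
  rw [zero_add] at hF hF'
  rw [← h0, ← h1] at hF'
  have hkF : ∀ {K : PreAbstractSimplicialComplex V} {p : ℤ → V}, IsLinkCycle K (τ : Set V) m p →
      ∀ k, IsFace K ({p k} ∪ (τ : Set V)) := fun hp k =>
    (hp.face k).subset (Set.union_subset_union_left _ (by simp)) (by simp)
  obtain ⟨f, hf, hfF, hfk⟩ := X.exists_iso_of_isFace hK hL hF (hkF hp k) hF'
    (hkl ▸ hkF hp' l)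
  have hv : ∀ k, p k ∈ vertices K := fun k => (hp.face k).mem_vertices (by simp)
  have hfτ : ∀ v ∈ (τ : Set V), f v = v := fun v hv => hfF v (Or.inr hv)
  have hτK : ∀ v ∈ (τ : Set V), v ∈ vertices K := fun v hv => (hp.face 0).mem_vertices (Or.inr hv)
  have h := hp'.eq_of_eq hm (q := fun k => f (p k)) (fun k l => ?_) (fun k hk => ?_) (fun k => ?_)
    ?_ ?_ k
  · rw [← hp'.eq_iff, ← h, ← hkl]
    exact hfk _ (by simp)
  · rw [hf.injOn.eq_iff (hv k) (hv l), hp.eq_iff]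
  · have := hf.injOn (hτK _ hk) (hv k) (hfτ _ hk)
    exact hp.notMem k (this ▸ hk)
  · have := hf.isFace_image (hp.face k)
    rwa [Set.image_union, Set.image_pair, Set.image_congr hfτ, Set.image_id'] at this
  · rw [← h0]; exact hfF _ (by simp)
  · rw [← h1]; exact hfF _ (by simp)

variable [DecidableEq V]

/-- The retraction of the link of `τ` onto an apartment, centered at an edge. -/
theorem exists_isFolding (hm : 2 ≤ m)
    (hcyc : ∀ K ∈ X.apartments, ∀ a b, a ∉ τ → b ∉ τ → a ≠ b → IsFace K ({a, b} ∪ (τ : Set V)) →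
      ∃ p, IsLinkCycle K τ m p ∧ p 0 = a ∧ p 1 = b)
    {a b : vertices (link X.complex τ)} (hab : (skeletonGraph (link X.complex τ)).Adj a b) :
    ∃ ρ, IsFolding (skeletonGraph (link X.complex τ)) m a b ρ := by
  obtain ⟨hne, hF⟩ := skeletonGraph_link_adj.1 hab
  have hne' : a.1 ≠ b.1 := fun h => hne (Subtype.ext h)
  have hτ : ∀ x : vertices (link X.complex τ), x.1 ∉ (τ : Set V) := fun x =>
    (mem_vertices_link.1 x.2).1
  have hm1 : m ≠ 1 := by omega
  have hex : ∀ x : vertices (link X.complex τ), ∃ k : ℤ, |k| ≤ m ∧ ∃ K ∈ X.apartments, ∃ p,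
      IsLinkCycle K τ m p ∧ p 0 = a.1 ∧ p 1 = b.1 ∧ p k = x.1 := by
    intro x
    obtain ⟨K, hK, h1, h2⟩ := X.exists_apartment_of_isFace hF (mem_vertices_link.1 x.2).2
    obtain ⟨p, hp, hpa, hpb⟩ := hcyc K hK a.1 b.1 (hτ a) (hτ b) hne' h1
    obtain ⟨k, hk⟩ := hp.exists_eq x.1 (hτ x) h2
    obtain ⟨l, hl, hlm⟩ := hp.exists_abs_le (by omega) k
    exact ⟨l, hlm, K, hK, p, hp, hpa, hpb, hl.trans hk.symm⟩
  choose ρ hρm Kx hKx px hpx hpa hpb hpρ using hex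
  have huniq : ∀ {L : PreAbstractSimplicialComplex V}, L ∈ X.apartments → ∀ {p' : ℤ → V},
      IsLinkCycle L τ m p' → p' 0 = a.1 → p' 1 = b.1 → ∀ (x : vertices (link X.complex τ)) (l : ℤ),
      x.1 = p' l → (2 * m : ℤ) ∣ ρ x - l := by
    intro L hL p' hp' h0 h1 x l hx
    exact X.dvd_sub_of_isLinkCycle hm1 (hKx x) hL (hpx x) hp' ((hpa x).trans h0.symm)
      ((hpb x).trans h1.symm) ((hpρ x).trans hx)
  have hedge : ∀ x y : vertices (link X.complex τ), (skeletonGraph (link X.complex τ)).Adj x y →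
      ∃ L ∈ X.apartments, ∃ p', IsLinkCycle L τ m p' ∧ p' 0 = a.1 ∧ p' 1 = b.1 ∧
        ∃ k, (x.1 = p' k ∧ y.1 = p' (k + 1)) ∨ (x.1 = p' (k + 1) ∧ y.1 = p' k) := by
    intro x y hxy
    obtain ⟨hxy, hFxy⟩ := skeletonGraph_link_adj.1 hxy
    obtain ⟨L, hL, h1, h2⟩ := X.exists_apartment_of_isFace hF hFxy
    obtain ⟨p, hp, hpa, hpb⟩ := hcyc L hL a.1 b.1 (hτ a) (hτ b) hne' h1
    exact ⟨L, hL, p, hp, hpa, hpb, hp.exists_edge x.1 y.1 (hτ x) (hτ y)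
      (fun h => hxy (Subtype.ext h)) h2⟩
  refine ⟨ρ, ⟨?_, ?_, fun b' hab' hb' => ?_, fun x y hxy => ?_, hρm, fun x => ?_⟩⟩
  · have h1 := huniq (hKx a) (hpx a) (hpa a) (hpb a) a 0 (hpa a).symm
    have h2 := hρm a
    rw [sub_zero] at h1
    exact Int.eq_zero_of_abs_lt_dvd h1 (by omega)
  · have h1 := huniq (hKx a) (hpx a) (hpa a) (hpb a) b 1 (hpb a).symm
    have h2 := abs_le.1 (hρm b)
    have := Int.eq_zero_of_abs_lt_dvd h1 (abs_lt.2 (by omega))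
    omega
  · obtain ⟨L, hL, p', hp', h0, h1, k, ⟨ha, hb⟩ | ⟨ha, hb⟩⟩ := hedge a b' hab'
    · rw [← h0, hp'.eq_iff] at ha
      refine absurd (Subtype.ext ?_) hb'
      rw [hb, ← h1, hp'.eq_iff, show k + 1 - 1 = -(0 - k) by ring, dvd_neg]
      exact ha
    · have := huniq hL hp' h0 h1 b' (-1) ?_
      · simpa using this
      · rw [hb, hp'.eq_iff]
        rw [← h0, hp'.eq_iff] at ha
        rw [show k - -1 = -(0 - (k + 1)) by ring, dvd_neg]
        exact ha
  · obtain ⟨L, hL, p', hp', h0, h1, k, ⟨hx, hy⟩ | ⟨hx, hy⟩⟩ := hedge x y hxy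
    · left
      have := dvd_sub (huniq hL hp' h0 h1 y _ hy) (huniq hL hp' h0 h1 x _ hx)
      rwa [show ρ y - (k + 1) - (ρ x - k) = ρ y - ρ x - 1 by ring] at this
    · right
      have := dvd_sub (huniq hL hp' h0 h1 y _ hy) (huniq hL hp' h0 h1 x _ hx)
      rwa [show ρ y - k - (ρ x - (k + 1)) = ρ y - ρ x + 1 by ring] at this
  · obtain ⟨q, hq⟩ := (hpx x).exists_walk (X.apartment_le _ (hKx x)) (ρ x)
    have e0 : (⟨px x 0, (hpx x).mem_vertices_link (X.apartment_le _ (hKx x)) 0⟩ :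
        vertices (link X.complex τ)) = a := Subtype.ext (hpa x)
    have e1 : (⟨px x (ρ x), (hpx x).mem_vertices_link (X.apartment_le _ (hKx x)) (ρ x)⟩ :
        vertices (link X.complex τ)) = x := Subtype.ext (hpρ x)
    exact ⟨q.copy e0 e1, by rw [SimpleGraph.Walk.length_copy]; exact hq⟩

variable {t : V → Fin (n + 1)}

/-- The degrees in one-dimensional links are bounded below by the thickness. -/
lemma le_degree {q : ℝ} (hthick : X.ThicknessAtLeast q) (hcard : τ.card + 1 = n)
    [Fintype (vertices (link X.complex τ))] [DecidableRel (skeletonGraph (link X.complex τ)).Adj]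
    (v : vertices (link X.complex τ)) : q ≤ (skeletonGraph (link X.complex τ)).degree v := by
  obtain ⟨hvτ, hF⟩ := mem_vertices_link.1 v.2
  have hface : {v.1} ∪ τ ∈ X.complex.faces := by
    rw [← isFace_coe]; simpa using hF
  have hσ : ({v.1} ∪ τ).card = n := by
    rw [Finset.card_union_of_disjoint (by simpa using hvτ), Finset.card_singleton]
    omega
  obtain ⟨T, hT, hqT⟩ := hthick _ hface hσ
  have hu : ∀ c ∈ T, ∃ u : vertices (link X.complex τ),
      (skeletonGraph (link X.complex τ)).Adj v u ∧ c = {u.1} ∪ ({v.1} ∪ τ) := by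
    intro c hc
    obtain ⟨hcX, hcn, hsub⟩ := hT c hc
    have h1 : (c \ ({v.1} ∪ τ)).card = 1 := by
      rw [Finset.card_sdiff_of_subset hsub]; omega
    obtain ⟨u, hu⟩ := Finset.card_eq_one.1 h1
    have hcu : c = {u} ∪ ({v.1} ∪ τ) := by
      rw [← hu, Finset.sdiff_union_of_subset hsub]
    have hun : u ∉ {v.1} ∪ τ := by
      have : u ∈ c \ ({v.1} ∪ τ) := hu ▸ Finset.mem_singleton_self u
      exact (Finset.mem_sdiff.1 this).2
    simp only [Finset.mem_union, Finset.mem_singleton, not_or] at hun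
    have hFc : IsFace X.complex ({v.1, u} ∪ (τ : Set V)) := by
      refine ⟨c, hcX, ?_⟩
      rw [hcu]
      ext x
      simp only [Finset.coe_union, Finset.coe_singleton, Set.mem_union, Set.mem_insert_iff,
        Set.mem_singleton_iff]
      tauto
    have huv : u ∈ vertices (link X.complex τ) := mem_vertices_link.2 ⟨hun.2,
      hFc.subset (Set.union_subset_union_left _ (by simp)) (by simp)⟩
    exact ⟨⟨u, huv⟩, skeletonGraph_link_adj.2 ⟨fun h => hun.1 (congrArg Subtype.val h).symm, hFc⟩,
      hcu⟩
  have : Nonempty (vertices (link X.complex τ)) := ⟨v⟩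
  choose! f hf hfc using hu
  refine hqT.trans ?_
  rw [← SimpleGraph.card_neighborFinset_eq_degree]
  refine Nat.cast_le.2 (Finset.card_le_card_of_injOn f (fun c hc => ?_) fun c hc d hd e => ?_)
  · simpa using hf c hc
  · rw [hfc c hc, hfc d hd, e]

end Building

namespace Building

variable {V : Type*} [DecidableEq V] {n : ℕ} (X : Building V n) {t : V → Fin (n + 1)}
  {M : CoxeterMatrix (Fin (n + 1))} {q : ℝ} {τ : Finset V} {i j : Fin (n + 1)}

omit [DecidableEq V] in
lemma card_of_cotype (ht : IsTypeFunction X.complex t) (hτX : τ ∈ X.complex.faces) (hij : i ≠ j)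
    (hτ : t '' (τ : Set V) = {i, j}ᶜ) : τ.card + 1 = n := by
  have h1 := (X.injOn_type ht (isFace_coe.2 hτX)).ncard_image
  have h2 := Set.ncard_add_ncard_compl ({i, j} : Set (Fin (n + 1)))
  rw [Set.ncard_pair hij, Nat.card_fin, ← hτ, h1, Set.ncard_coe_finset] at h2
  omega

omit [DecidableEq V] in
lemma type_mem_of_link (ht : IsTypeFunction X.complex t) (hτ : t '' (τ : Set V) = {i, j}ᶜ) {x : V}
    (hx : x ∉ τ) (hF : IsFace X.complex ({x} ∪ (τ : Set V))) : t x = i ∨ t x = j := by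
  by_contra h
  have h1 : t x ∈ t '' (τ : Set V) := by
    rw [hτ]; simpa using h
  obtain ⟨y, hy, e⟩ := h1
  exact hx (X.injOn_type ht hF (Or.inr hy) (by simp) e ▸ hy)

omit [DecidableEq V] in
lemma exists_isLinkCycle_of_cotype (ht : IsTypeFunction X.complex t)
    (hM : X.HasCoxeterMatrix t M) (hind : SimpleIndep M) (hτ : t '' (τ : Set V) = {i, j}ᶜ)
    {K : PreAbstractSimplicialComplex V} (hK : K ∈ X.apartments) {a b : V} (ha : a ∉ τ)
    (hb : b ∉ τ) (hab : a ≠ b) (hF : IsFace K ({a, b} ∪ (τ : Set V))) :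
    ∃ p, IsLinkCycle K τ (orderOf (M.simple i * M.simple j)) p ∧ p 0 = a ∧ p 1 = b := by
  have hFX := hF.mono (X.apartment_le K hK)
  have htab : t a ≠ t b := fun h =>
    hab (X.injOn_type ht hFX (by simp) (by simp) h)
  have hta := X.type_mem_of_link ht hτ ha
    (hFX.subset (Set.union_subset_union_left _ (by simp)) (by simp))
  have htb := X.type_mem_of_link ht hτ hb
    (hFX.subset (Set.union_subset_union_left _ (by simp)) (by simp))
  have hpair : ({i, j} : Set (Fin (n + 1))) = {t a, t b} ∧
      orderOf (M.simple i * M.simple j) = orderOf (M.simple (t a) * M.simple (t b)) := by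
    rcases hta with h1 | h1 <;> rcases htb with h2 | h2
    · exact absurd (h1.trans h2.symm) htab
    · rw [h1, h2]; exact ⟨rfl, rfl⟩
    · rw [h1, h2]
      refine ⟨Set.pair_comm _ _, ?_⟩
      rw [← orderOf_inv, mul_inv_rev, simple_inv, simple_inv]
    · exact absurd (h1.trans h2.symm) htab
  rw [hpair.2]
  rw [hpair.1] at hτ
  exact X.exists_isLinkCycle ht hM hind hK htab hτ hF

/-- The second eigenvalue of a one-dimensional link is nonnegative and bounded in terms of the
thickness and the cosine matrix of the Coxeter matrix. -/
theorem linkEigenvalue_nonneg_and_le (hn : 2 ≤ n) (ht : IsTypeFunction X.complex t)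
    (hM : X.HasCoxeterMatrix t M) (hq : 2 ≤ q) (hthick : X.ThicknessAtLeast (q + 1))
    (hfin : X.FiniteOneDimLinks) (hij : i ≠ j) (hτX : τ ∈ X.complex.faces)
    (hτ : t '' (τ : Set V) = {i, j}ᶜ) :
    0 ≤ linkEigenvalue X.complex τ ∧
      linkEigenvalue X.complex τ ≤ -(2 * √q / (q + 1) * coxeterCosineMatrix M i j) := by
  classical
  have hcard := X.card_of_cotype ht hτX hij hτ
  have hf := hfin τ hτX hcard
  have hind := X.simpleIndep (by omega) ht hM (by linarith : 1 < q + 1) hthick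
  rw [linkEigenvalue, dif_pos hf]
  let := hf.fintype
  set G := skeletonGraph (link X.complex τ) with hGdef
  set m := orderOf (M.simple i * M.simple j) with hmdef
  have hdeg : ∀ v, q + 1 ≤ G.degree v := X.le_degree hthick hcard
  have hdeg3 : ∀ v, 3 ≤ G.degree v := by
    intro v
    have h1 : (3 : ℝ) ≤ G.degree v := by linarith [hdeg v]
    exact_mod_cast h1
  have hcyc : ∀ K ∈ X.apartments, ∀ a b, a ∉ τ → b ∉ τ → a ≠ b →
      IsFace K ({a, b} ∪ (τ : Set V)) → ∃ p, IsLinkCycle K τ m p ∧ p 0 = a ∧ p 1 = b :=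
    fun K hK a b ha hb hab hF => X.exists_isLinkCycle_of_cotype ht hM hind hτ hK ha hb hab hF
  have hne : Nonempty (vertices (link X.complex τ)) := by
    obtain ⟨K, hK, h1, -⟩ := X.exists_apartment_of_isFace (isFace_coe.2 hτX) (isFace_coe.2 hτX)
    obtain ⟨C, hC, hτC, -, hCcard⟩ := X.exists_chamber ht hK h1
    obtain ⟨x, hxC, hx⟩ := Set.exists_mem_notMem_of_ncard_lt_ncard
      (show (τ : Set V).ncard < C.ncard by rw [Set.ncard_coe_finset]; omega)
    refine ⟨x, mem_vertices_link.2 ⟨hx, ?_⟩⟩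
    exact (hC.subset (Set.union_subset (Set.singleton_subset_iff.2 hxC) hτC) (by simp)).mono
      (X.apartment_le K hK)
  have hnbr : ∀ a, ∃ b, G.Adj a b := fun a =>
    let ⟨b, hb, _⟩ := IsGenPolygon.exists_third_neighbor hdeg3 a a a
    ⟨b, hb⟩
  have hm : 2 ≤ m := by
    obtain ⟨a⟩ := hne
    obtain ⟨b, hab⟩ := hnbr a
    obtain ⟨b', hab', hb', -⟩ := IsGenPolygon.exists_third_neighbor hdeg3 a b b
    obtain ⟨hab1, hF⟩ := skeletonGraph_link_adj.1 hab
    obtain ⟨hab2, hF'⟩ := skeletonGraph_link_adj.1 hab'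
    obtain ⟨K, hK, h1, h2⟩ := X.exists_apartment_of_isFace hF hF'
    have hτ' : ∀ x : vertices (link X.complex τ), x.1 ∉ τ := fun x => (mem_vertices_link.1 x.2).1
    obtain ⟨p, hp, hpa, hpb⟩ := hcyc K hK a.1 b.1 (hτ' a) (hτ' b)
      (fun h => hab1 (Subtype.ext h)) h1
    by_contra! hlt
    have hm01 : m = 0 ∨ m = 1 := by omega
    rcases hm01 with h0 | h1
    · have hinj : Function.Injective fun k : ℤ =>
          (⟨p k, hp.mem_vertices_link (X.apartment_le K hK) k⟩ :
            vertices (link X.complex τ)) := by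
        intro k l hkl
        have h3 : p k = p l := congrArg Subtype.val hkl
        rw [hp.eq_iff, h0] at h3
        simp only [CharP.cast_eq_zero, mul_zero, zero_dvd_iff] at h3
        omega
      exact not_injective_infinite_finite _ hinj
    · have hmod : ∀ k l : ℤ, p k = p l ↔ (2 : ℤ) ∣ k - l := by
        intro k l
        rw [hp.eq_iff, h1]
        simp
      obtain ⟨k, ⟨ha, hb⟩ | ⟨ha, hb⟩⟩ := hp.exists_edge a.1 b'.1 (hτ' a) (hτ' b')
        (fun h => hab2 (Subtype.ext h)) h2
      · rw [← hpa, hmod] at ha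
        refine hb' (Subtype.ext ?_)
        rw [hb, ← hpb, hmod]
        omega
      · rw [← hpa, hmod] at ha
        refine hb' (Subtype.ext ?_)
        rw [hb, ← hpb, hmod]
        omega
  have hG : IsGenPolygon G m := isGenPolygon_of_isFolding hm hnbr fun a b hab =>
    X.exists_isFolding hm hcyc hab
  have hdvd : m ∣ M i j :=
    orderOf_dvd_of_pow_eq_one (M.toCoxeterSystem.simple_mul_simple_pow i j)
  refine ⟨hG.secondEigenvalue_nonneg hm hq hdeg,
    (hG.secondEigenvalue_le hm hq hdeg).trans ?_⟩
  have h1 := mul_le_mul_of_nonneg_left (coxeterCosineMatrix_le M hm hdvd)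
    (by positivity : 0 ≤ 2 * √q / (q + 1))
  linarith

end Building

end BuildingCosine

theorem lemma4p5 {V : Type*} [DecidableEq V] {n : ℕ} (hn : 2 ≤ n)
    (X : BuildingCosine.Building V n)
    (t : V → Fin (n + 1)) (ht : BuildingCosine.IsTypeFunction X.complex t)
    (M : CoxeterMatrix (Fin (n + 1))) (hM : X.HasCoxeterMatrix t M)
    (q : ℝ) (hq : 2 ≤ q) (hthick : X.ThicknessAtLeast (q + 1))
    (hfin : X.FiniteOneDimLinks)
    (r : Finset (Fin (n + 1)) → Finset V)
    (hr : BuildingCosine.IsRepresentativeChoice X.complex t r) :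
    (∀ i j : Fin (n + 1),
      ((2 * Real.sqrt q / (q + 1)) • BuildingCosine.coxeterCosineMatrix M +
          (1 - 2 * Real.sqrt q / (q + 1)) •
            (1 : Matrix (Fin (n + 1)) (Fin (n + 1)) ℝ)) i j ≤
        BuildingCosine.cosineMatrix X.complex r i j) ∧
    (∀ μ : ℝ,
      IsLeast {x : ℝ | Module.End.HasEigenvalue
        (Matrix.toLin' (BuildingCosine.coxeterCosineMatrix M)) x} μ →
      1 - (q + 1) / (2 * Real.sqrt q) < μ →
      (BuildingCosine.cosineMatrix X.complex r).PosDef) := by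
  have key : ∀ i j, i ≠ j → 0 ≤ BuildingCosine.linkEigenvalue X.complex (r {i, j}) ∧
      BuildingCosine.linkEigenvalue X.complex (r {i, j}) ≤
        -(2 * √q / (q + 1) * BuildingCosine.coxeterCosineMatrix M i j) := fun i j hij =>
    X.linkEigenvalue_nonneg_and_le hn ht hM hq hthick hfin hij (hr i j hij).1 (hr i j hij).2
  have hdiag : ∀ i, BuildingCosine.cosineMatrix X.complex r i i = 1 := fun i => if_pos rfl
  have hoff : ∀ i j, i ≠ j → BuildingCosine.cosineMatrix X.complex r i j =
      -BuildingCosine.linkEigenvalue X.complex (r {i, j}) := fun i j hij => if_neg hij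
  refine ⟨fun i j => ?_, fun μ hμ hlt => ?_⟩
  · rw [Matrix.add_apply, Matrix.smul_apply, Matrix.smul_apply, smul_eq_mul, smul_eq_mul]
    by_cases hij : i = j
    · subst hij
      rw [hdiag, BuildingCosine.coxeterCosineMatrix_diag, Matrix.one_apply_eq]
      linarith
    · rw [hoff i j hij, Matrix.one_apply_ne hij]
      linarith [(key i j hij).2]
  · have hsq : 0 < √q := Real.sqrt_pos.2 (by linarith)
    refine BuildingCosine.posDef_of_abs_le (κ := 2 * √q / (q + 1)) ?_
      (BuildingCosine.coxeterCosineMatrix_isHermitian M) (by positivity) hdiag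
      (BuildingCosine.coxeterCosineMatrix_diag M) (fun i j hij => ?_) hμ ?_
    · ext i j
      by_cases hij : i = j
      · subst hij; simp
      · rw [Matrix.conjTranspose_apply, star_trivial, hoff i j hij, hoff j i (Ne.symm hij),
          Finset.pair_comm]
    · rw [hoff i j hij, abs_neg, abs_of_nonneg (key i j hij).1]
      exact (key i j hij).2
    · rwa [one_div_div]
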